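/- **Model.** A dynamic stream inserts and deletes points, one per operation. A dynamic algorithm learns distances only through queries $d(x,y)$ to an oracle, for points $x,y$ inserted (and possibly deleted) so far; after each operation it reports a nonempty set of centers (points inserted so far) and/or a number. A *metric-adaptive adversary* chooses the operations and answers the queries on the fly, based on the operations, queries, answers and reports so far; its only restriction is that at any time some metric is consistent with all its answers. Let $f(k,n)$ be nondecreasing in $n$ for each $k$. The algorithm has *amortized update time* $f(k,n)$ if at any time its total number of steps (computation steps and distance queries) is at most the number of operations so far times $f(k,n_{\max})$, with $n_{\max}$ the largest number of points present simultaneously so far. (This is implied if operation $i$ is charged only $f(k,n_i)$, with $n_i$ the number of points present at that operation.) Write $\tilde f=\max\{2,f\}$. The objectives for the current point set $P$, a set $C$ of centers and an assignment $\ell:P\to C$ are: $k$-center $\max_{p}d(p,\ell(p))$; $(k,z)$-clustering $\sum_p d(p,\ell(p))^z$ ($z>0$ real; $k$-median is $z=1$, $k$-means is $z=2$); $k$-sum-of-radii $\sum_{c\in C}\max_{p\in\ell^{-1}(c)}d(p,c)$; $k$-sum-of-diameters $\sum_{c\in C}\max_{p,q\in\ell^{-1}(c)}d(p,q)$. $\mathrm{OPT}$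 is the minimum over $C\subseteq P$ with $|C|\le k$ and over $\ell$. The algorithm has *approximation ratio* $\alpha(n)$ if at any time, for every metric consistent with the answers so far, the cost of its centers (with the best assignment) is at most $\alpha(n)\cdot\mathrm{OPT}$, where $n=|P|\geq 1$. It *estimates the cost within ratio* $\alpha(n)$ if at any time with $n=|P|\ge1$ the reported number $e$ satisfies $\mathrm{OPT}\le e\le\alpha(n)\cdot\mathrm{OPT}$ for every such metric. **Theorem.** For every integer $a\ge 1$ there is a constant $c>0$, depending only on $a$, such that for every such $f$ the following holds. 1. Let $k\ge1$. For every $N>ak$ there is a metric-adaptive adversary such that, for every algorithm with amortized update time $f(k,n)$ that reports at most $ak$ centers and has $k$-center approximation ratio $\alpha$ against this adversary, some $n\in[N,4N]$ has $$\alpha(n)\ \ge\ c\cdot\min\Big\{\frac{\log n}{k\log \tilde f(k,2n)},\,k\Big\}.$$ 2. In the same sense (with $k=1$, at most $a$ reported centers, and every $N>a$), for algorithms with amortized update time $f(1,n)$: $1$-median has $\alpha(n)\ge c\,\frac{\log n}{\log\tilde f(1,2n)}$; $1$-means has $\alpha(n)\ge c\big(\frac{\log n}{\log\tilde f(1,2n)}\big)^2$;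 and, for every real $z>0$, $(1,z)$-clustering has $\alpha(n)\ge c\Big(c\,\frac{\log n}{z+\log\tilde f(1,2n)}\Big)^z$. 3. For each of $1$-center, $1$-sum-of-radii and $1$-sum-of-diameters, and for every $N\ge2$, there is a metric-adaptive adversary such that, for every algorithm with amortized update time $f(1,n)$ that estimates the cost within ratio $\alpha$ against this adversary, some $n\in[N,4N]$ has $\alpha(n)\ge c\,\frac{\log n}{\log\tilde f(1,2n)}$. -/

import Mathlib

open scoped NNReal

namespace DynClustering

/-! ## Clustering objectives -/

/-- Names of the points that may occur in a dynamic stream. The metric on them is not fixed. -/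
def Point : Type := ℕ

instance : DecidableEq Point := inferInstanceAs (DecidableEq ℕ)

/-- The cost, in the metric `M`, of the clustering of the point set `P` that has the set of
centers `C` and assigns every `p ∈ P` to the center `l p`. -/
abbrev Objective : Type :=
  (M : MetricSpace Point) → (P C : Finset Point) → (l : Point → Point) → ℝ

/-- `k`-center: `max_{p ∈ P} d(p, l p)`. -/
noncomputable def centerObj : Objective := fun _ P _ l =>
  ((P.sup fun p => nndist p (l p) : ℝ≥0) : ℝ)

/-- `(k,z)`-clustering: `∑_{p ∈ P} d(p, l p)^z`. -/
noncomputable def powerObj (z : ℝ) : Objective := fun _ P _ l =>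
  ∑ p ∈ P, dist p (l p) ^ z

/-- `k`-median: `∑_{p ∈ P} d(p, l p)`. -/
noncomputable def medianObj : Objective := fun _ P _ l =>
  ∑ p ∈ P, dist p (l p)

/-- `k`-means: `∑_{p ∈ P} d(p, l p)²`. -/
noncomputable def meansObj : Objective := fun _ P _ l =>
  ∑ p ∈ P, dist p (l p) ^ 2

/-- `k`-sum-of-radii: `∑_{c ∈ C} max_{p ∈ l⁻¹(c)} d(p, c)`. -/
noncomputable def radiiObj : Objective := fun _ P C l =>
  ∑ c ∈ C, (((P.filter fun p => l p = c).sup fun p => nndist p c : ℝ≥0) : ℝ)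

/-- `k`-sum-of-diameters: `∑_{c ∈ C} max_{p, q ∈ l⁻¹(c)} d(p, q)`. -/
noncomputable def diamObj : Objective := fun _ P C l =>
  ∑ c ∈ C, Metric.diam {p : Point | p ∈ P ∧ l p = c}

/-- The cost of a nonempty set of centers `C` for `P`: the best assignment of the points of `P`
to centers in `C` is used. The centers need not belong to `P`. -/
noncomputable def costOf (obj : Objective) (M : MetricSpace Point) (P C : Finset Point) : ℝ :=
  sInf {r : ℝ | ∃ l : Point → Point, (∀ p ∈ P, l p ∈ C) ∧ r = obj M P C l}

/-- The optimal cost of clustering `P` with at most `k` centers taken from `P`. -/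
noncomputable def optCost (obj : Objective) (k : ℕ) (M : MetricSpace Point)
    (P : Finset Point) : ℝ :=
  sInf {r : ℝ | ∃ C : Finset Point, C ⊆ P ∧ C.card ≤ k ∧
    ∃ l : Point → Point, (∀ p ∈ P, l p ∈ C) ∧ r = obj M P C l}

/-! ## Streams and transcripts -/

/-- An operation of the stream. -/
inductive Update : Type
  | ins (p : Point)
  | del (p : Point)

/-- What an algorithm reports after an operation: a set of centers and an estimate of the
optimal cost. -/
structure Output : Type where
  centers : Finset Point
  estimate : ℝ

/-- The events that both the algorithm and the adversary observe. -/
inductive Event : Type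
  | update (u : Update)
  | query (x y : Point) (r : ℝ)
  | output (o : Output)

/-- A transcript of the interaction, with the newest event first. -/
abbrev History : Type := List Event

/-- The current points. -/
def active : History → Finset Point
  | [] => ∅
  | .update (.ins p) :: h => insert p (active h)
  | .update (.del p) :: h => (active h).erase p
  | .query _ _ _ :: h => active h
  | .output _ :: h => active h

/-- All points inserted so far, including those that have been deleted again. -/
def inserted : History → Finset Point
  | [] => ∅
  | .update (.ins p) :: h => insert p (inserted h)
  | .update (.del _) :: h => inserted h
  | .query _ _ _ :: h => inserted h
  | .output _ :: h => inserted h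

/-- The number of operations so far. -/
def numUpdates : History → ℕ
  | [] => 0
  | .update _ :: h => numUpdates h + 1
  | .query _ _ _ :: h => numUpdates h
  | .output _ :: h => numUpdates h

/-- The largest number of points that were present at the same time so far. -/
def peak : History → ℕ
  | [] => 0
  | e :: h => max (peak h) (active (e :: h)).card

/-- Only absent points are inserted and only current points are deleted. -/
def LegalStream : History → Prop
  | [] => True
  | .update (.ins p) :: h => p ∉ active h ∧ LegalStream h
  | .update (.del p) :: h => p ∈ active h ∧ LegalStream h
  | .query _ _ _ :: h => LegalStream h
  | .output _ :: h => LegalStream h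

/-- The metric `M` agrees with every answer to a distance query in the transcript. -/
def Consistent (M : MetricSpace Point) (h : History) : Prop :=
  ∀ x y r, Event.query x y r ∈ h → M.dist x y = r

/-! ## Algorithms, adversaries, and their interaction -/

/-- One step of an algorithm in a state of type `σ`: an internal computation step, a query to
the distance oracle (the next state depends on the answer), or the end of the processing of the
current operation with a report. -/
inductive Action (σ : Type) : Type
  | compute (s : σ)
  | query (x y : Point) (next : ℝ → σ)
  | output (o : Output)

/-- A dynamic algorithm, as an arbitrary transition system: `receive` reads the next operation
of the stream, `step` is one step while an operation is being processed. The set of states and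
the power of an internal computation step are not restricted. -/
structure Algorithm : Type 1 where
  State : Type
  init : State
  receive : State → Update → State
  step : State → Action State

/-- An adversary: it chooses operations, and answers distance queries, on the basis of the
transcript alone. It sees neither the state of the algorithm nor the queries to come. -/
structure Adversary : Type where
  nextUpdate : History → Update
  answer : History → Point → Point → ℝ

/-- A configuration of the interaction. `busy` tells whether an operation is being processed,
`time` counts the steps (computation steps and distance queries) made in total so far. -/
structure Config (A : Algorithm) : Type where
  state : A.State
  busy : Bool
  hist : History
  time : ℕ

/-- One step of the interaction. Distance queries are answered only for points that have been
inserted before; other queries give no information (but do cost time). -/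
noncomputable def Config.next {A : Algorithm} (𝒜 : Adversary) (c : Config A) : Config A :=
  match c.busy with
  | false =>
    { state := A.receive c.state (𝒜.nextUpdate c.hist)
      busy := true
      hist := .update (𝒜.nextUpdate c.hist) :: c.hist
      time := c.time }
  | true =>
    match A.step c.state with
    | .compute s => { state := s, busy := true, hist := c.hist, time := c.time + 1 }
    | .query x y nxt =>
      if x ∈ inserted c.hist ∧ y ∈ inserted c.hist then
        { state := nxt (𝒜.answer c.hist x y)
          busy := true
          hist := .query x y (𝒜.answer c.hist x y) :: c.hist
          time := c.time + 1 }
      else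
        { state := nxt 0, busy := true, hist := c.hist, time := c.time + 1 }
    | .output o =>
      { state := c.state, busy := false, hist := .output o :: c.hist, time := c.time }

/-- The configuration after `m` steps of the interaction of `A` with `𝒜`. -/
noncomputable def play (A : Algorithm) (𝒜 : Adversary) : ℕ → Config A
  | 0 => { state := A.init, busy := false, hist := [], time := 0 }
  | m + 1 => (play A 𝒜 m).next 𝒜

/-- `𝒜` is a metric-adaptive adversary: whatever the algorithm, its operations are legal, and
at any time there is a metric that is consistent with all the answers it has given. -/
def Adversary.IsMetricAdaptive (𝒜 : Adversary) : Prop :=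
  ∀ (A : Algorithm) (m : ℕ), LegalStream (play A 𝒜 m).hist ∧
    ∃ M : MetricSpace Point, Consistent M (play A 𝒜 m).hist

/-- Against `𝒜`, the amortized update time of `A` is at most `f n`: at any time, the total
number of steps is at most `f n` times the number of operations so far, where `n` is the largest
number of points present so far. In particular, every operation is eventually processed. (For a
nondecreasing `f` this is implied by the requirement that charges to each operation only
`f` of the number of points present at that operation.) -/
def HasUpdateTime (A : Algorithm) (𝒜 : Adversary) (f : ℕ → ℝ) : Prop :=
  ∀ m : ℕ, ((play A 𝒜 m).time : ℝ) ≤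
    (numUpdates (play A 𝒜 m).hist : ℝ) * f (peak (play A 𝒜 m).hist)

/-- Against `𝒜`, whenever `A` reports, it reports at most `g` centers, each of which is a point
inserted before (and possibly deleted), and at least one if there is a point to be served. -/
def OutputsCenters (A : Algorithm) (𝒜 : Adversary) (g : ℕ) : Prop :=
  ∀ (m : ℕ) (o : Output) (h : History), (play A 𝒜 m).hist = .output o :: h →
    o.centers ⊆ inserted h ∧ o.centers.card ≤ g ∧
      ((active h).Nonempty → o.centers.Nonempty)

/-- Against `𝒜`, the centers reported by `A` are always an `α n`-approximation (with respect to
the optimal solution with `k` centers), where `n` is the current number of points. Since the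
metric is chosen adaptively, this is required for every metric consistent with the answers. -/
def HasApproxRatio (A : Algorithm) (𝒜 : Adversary) (obj : Objective) (k : ℕ)
    (α : ℕ → ℝ) : Prop :=
  ∀ (m : ℕ) (o : Output) (h : History), (play A 𝒜 m).hist = .output o :: h →
    (active h).Nonempty → ∀ M : MetricSpace Point, Consistent M h →
      costOf obj M (active h) o.centers ≤
        α (active h).card * optCost obj k M (active h)

/-- Against `𝒜`, the value reported by `A` is always at least the optimal cost and at most
`α n` times the optimal cost, where `n` is the current number of points. -/
def HasEstimateRatio (A : Algorithm) (𝒜 : Adversary) (obj : Objective) (k : ℕ)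
    (α : ℕ → ℝ) : Prop :=
  ∀ (m : ℕ) (o : Output) (h : History), (play A 𝒜 m).hist = .output o :: h →
    (active h).Nonempty → ∀ M : MetricSpace Point, Consistent M h →
      optCost obj k M (active h) ≤ o.estimate ∧
        o.estimate ≤ α (active h).card * optCost obj k M (active h)

/-- `bound n` is a lower bound, at every scale `N` of the number `n` of points, on the
approximation ratio of algorithms with amortized update time `f` that report at most `g` centers
(`g < N`): one and the same metric-adaptive adversary enforces it against all of them. -/
def CentersLowerBound (obj : Objective) (k g : ℕ) (f bound : ℕ → ℝ) : Prop :=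
  ∀ N : ℕ, g < N → ∃ 𝒜 : Adversary, 𝒜.IsMetricAdaptive ∧
    ∀ A : Algorithm, HasUpdateTime A 𝒜 f → OutputsCenters A 𝒜 g →
      ∀ α : ℕ → ℝ, HasApproxRatio A 𝒜 obj k α →
        ∃ n : ℕ, N ≤ n ∧ n ≤ 4 * N ∧ bound n ≤ α n

/-- The same for algorithms that estimate the optimal cost (at scales `N ≥ 2`). -/
def EstimateLowerBound (obj : Objective) (k : ℕ) (f bound : ℕ → ℝ) : Prop :=
  ∀ N : ℕ, 2 ≤ N → ∃ 𝒜 : Adversary, 𝒜.IsMetricAdaptive ∧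
    ∀ A : Algorithm, HasUpdateTime A 𝒜 f →
      ∀ α : ℕ → ℝ, HasEstimateRatio A 𝒜 obj k α →
        ∃ n : ℕ, N ≤ n ∧ n ≤ 4 * N ∧ bound n ≤ α n

/-- `log f`, with `f` replaced by `2` where it is smaller than `2`. -/
noncomputable def logTime (f : ℕ → ℕ → ℝ) (k n : ℕ) : ℝ := Real.log (max 2 (f k n))

end DynClustering

open DynClustering

/-! The adversary commits to as little of the metric as possible. It keeps a graph in which at most
`D` edges end at each point, and answers queries by the distance, capped at `L`, in the `hull`,
where in addition all points with fewer than `D` edges (the unsaturated ones) are joined pairwise. A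
shortest path in the hull can be rerouted to use at most one uncommitted pair
(`edist_le_length_or_detour`); committing that pair makes the answer a distance in the graph as
well. Afterwards the graph only grows and the hull only shrinks, so every answer stays the capped
distance in both (`Certified.query`). Hence for any `φ ≤ L` that changes by at most 1 along edges,
the maximum of the capped hull distance and `|φ x - φ y|` is a consistent metric
(`Certified.consistent_levelMetric`).

Saturated points get deleted. A query adds at most one edge, so with `D` at least 8 times the time
bound only half of the `2 * N` points can be lost before some report finds all current points
unsaturated (`exists_settled_output`). These points are within hull distance 1 of each other, so `φ`
alone governs their larger distances. Let `φ` be the capped graph distance from the reported centers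
`C`. The degree bound leaves at most `C.card * (D + 1) ^ (L - 1)` points with `φ < L`, so for `L` of
order `log N / log D` points at distance `L` from `C` remain. Yet a center at level `L` serves every
point of that level at distance at most 1, and `k` centers with radius 1 cover `2 * k` consecutive
levels. For estimates, the same transcript is consistent with a metric of diameter at most 1 on the
current points (`C = ∅`) and with one that has two of them at distance at least `L` (`C` a single
point). -/

namespace DynClustering

/-! ## Capped graph distances -/

section CapDist

variable {V : Type*}

/-- The distance in the graph `G`, cut off at `L`. -/
noncomputable def capDist (G : SimpleGraph V) (L : ℕ) (x y : V) : ℕ :=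
  (min (L : ℕ∞) (G.edist x y)).toNat

theorem coe_capDist (G : SimpleGraph V) (L : ℕ) (x y : V) :
    (capDist G L x y : ℕ∞) = min (L : ℕ∞) (G.edist x y) :=
  ENat.natCast_toNat (ne_top_of_le_ne_top (ENat.natCast_ne_top L) (min_le_left _ _))

theorem capDist_self (G : SimpleGraph V) (L : ℕ) (x : V) : capDist G L x x = 0 := by
  simp [capDist]

theorem capDist_comm (G : SimpleGraph V) (L : ℕ) (x y : V) :
    capDist G L x y = capDist G L y x := by
  simp [capDist, SimpleGraph.edist_comm]

theorem capDist_le_of_edist_le {G H : SimpleGraph V} {L : ℕ} {x y : V}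
    (h : G.edist x y ≤ H.edist x y) : capDist G L x y ≤ capDist H L x y := by
  rw [← Nat.cast_le (α := ℕ∞), coe_capDist, coe_capDist]
  exact min_le_min_left _ h

theorem capDist_anti {G H : SimpleGraph V} (h : G ≤ H) (L : ℕ) (x y : V) :
    capDist H L x y ≤ capDist G L x y :=
  capDist_le_of_edist_le (SimpleGraph.edist_anti h)

theorem capDist_triangle (G : SimpleGraph V) (L : ℕ) (x y z : V) :
    capDist G L x z ≤ capDist G L x y + capDist G L y z := by
  rw [← Nat.cast_le (α := ℕ∞), Nat.cast_add, coe_capDist, coe_capDist, coe_capDist]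
  rcases le_total (L : ℕ∞) (G.edist x y) with h | h
  · rw [min_eq_left h]
    exact (min_le_left _ _).trans le_self_add
  · rcases le_total (L : ℕ∞) (G.edist y z) with h' | h'
    · rw [min_eq_left h']
      exact (min_le_left _ _).trans le_add_self
    · rw [min_eq_right h, min_eq_right h']
      exact (min_le_right _ _).trans SimpleGraph.edist_triangle

theorem capDist_pos (G : SimpleGraph V) {L : ℕ} (hL : 1 ≤ L) {x y : V} (h : x ≠ y) :
    1 ≤ capDist G L x y := by
  rw [← Nat.cast_le (α := ℕ∞), coe_capDist]
  refine le_min (by exact_mod_cast hL) ?_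
  exact_mod_cast Order.one_le_iff_pos.2 (SimpleGraph.edist_pos_of_ne h)

theorem capDist_le_one_of_adj {G : SimpleGraph V} (L : ℕ) {x y : V} (h : G.Adj x y) :
    capDist G L x y ≤ 1 := by
  rw [← Nat.cast_le (α := ℕ∞), coe_capDist]
  exact (min_le_right _ _).trans (by simpa using (SimpleGraph.edist_eq_one_iff_adj.2 h).le)

theorem le_add_length_of_walk {G : SimpleGraph V} {φ : V → ℕ}
    (hφ : ∀ u v, G.Adj u v → φ v ≤ φ u + 1) {x y : V} (p : G.Walk x y) :
    φ y ≤ φ x + p.length := by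
  induction p with
  | nil => simp
  | cons h p ih =>
    have := hφ _ _ h
    rw [SimpleGraph.Walk.length_cons]
    omega

/-- Where the cap is active, `φ y ≤ L` already suffices; elsewhere a shortest walk is followed. This
is why levels and answers are capped at the same `L`. -/
theorem le_add_capDist {G : SimpleGraph V} {L : ℕ} {φ : V → ℕ} (hφL : ∀ v, φ v ≤ L)
    (hφ : ∀ u v, G.Adj u v → φ v ≤ φ u + 1) (x y : V) : φ y ≤ φ x + capDist G L x y := by
  rcases le_total (L : ℕ∞) (G.edist x y) with h | h
  · have h' := coe_capDist G L x y
    rw [min_eq_left h] at h'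
    have : capDist G L x y = L := by exact_mod_cast h'
    have := hφL y
    omega
  · have h' := coe_capDist G L x y
    rw [min_eq_right h] at h'
    obtain ⟨p, hp⟩ := SimpleGraph.exists_walk_of_edist_eq_coe h'.symm
    rw [← hp]
    exact le_add_length_of_walk hφ p

/-- The metric that is the maximum of a capped graph distance and of `|φ x - φ y|`. -/
@[reducible] noncomputable def levelMetric (G : SimpleGraph V) (L : ℕ) (hL : 1 ≤ L) (φ : V → ℕ) :
    MetricSpace V where
  dist x y := max (capDist G L x y : ℝ) |(φ x : ℝ) - φ y|
  dist_self x := by simp [capDist_self]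
  dist_comm x y := by rw [capDist_comm, abs_sub_comm]
  dist_triangle x y z := by
    refine max_le ?_ ?_
    · have h : (capDist G L x z : ℝ) ≤ capDist G L x y + capDist G L y z := by
        exact_mod_cast capDist_triangle G L x y z
      exact h.trans (add_le_add (le_max_left _ _) (le_max_left _ _))
    · exact (abs_sub_le _ _ _).trans (add_le_add (le_max_right _ _) (le_max_right _ _))
  eq_of_dist_eq_zero {x y} h := by
    by_contra hne
    have h1 : (1 : ℝ) ≤ capDist G L x y := by exact_mod_cast capDist_pos G hL hne
    have h2 := le_max_left (capDist G L x y : ℝ) |(φ x : ℝ) - φ y|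
    have h3 : max (capDist G L x y : ℝ) |(φ x : ℝ) - φ y| = 0 := h
    linarith

end CapDist

/-! ## The graph that the adversary maintains -/

/-- The graph with the given list of edges. -/
def edgeGraph (E : List (Point × Point)) : SimpleGraph Point :=
  SimpleGraph.fromRel fun u v => (u, v) ∈ E

/-- The other endpoints of the listed edges at `v`. -/
def nbrs : List (Point × Point) → Point → List Point
  | [], _ => []
  | e :: E, v => if e.1 = v then e.2 :: nbrs E v else if e.2 = v then e.1 :: nbrs E v else nbrs E v

/-- The number of listed edges at `v`. -/
def load (E : List (Point × Point)) (v : Point) : ℕ := (nbrs E v).length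

theorem mem_nbrs_left {E : List (Point × Point)} {u v : Point} (h : (u, v) ∈ E) :
    v ∈ nbrs E u := by
  induction E with
  | nil => simp at h
  | cons e E ih =>
    rcases List.mem_cons.1 h with rfl | h
    · simp [nbrs]
    · have := ih h
      unfold nbrs
      split_ifs <;> simp [this]

theorem mem_nbrs_right {E : List (Point × Point)} {u v : Point} (h : (v, u) ∈ E) (hne : u ≠ v) :
    v ∈ nbrs E u := by
  induction E with
  | nil => simp at h
  | cons e E ih =>
    rcases List.mem_cons.1 h with rfl | h
    · simp [nbrs, hne.symm]
    · have := ih h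
      unfold nbrs
      split_ifs <;> simp [this]

theorem mem_nbrs_of_adj {E : List (Point × Point)} {u v : Point} (h : (edgeGraph E).Adj u v) :
    v ∈ nbrs E u := by
  obtain ⟨hne, h | h⟩ := (SimpleGraph.fromRel_adj _ _ _).1 h
  · exact mem_nbrs_left h
  · exact mem_nbrs_right h hne

theorem load_cons_le (e : Point × Point) (E : List (Point × Point)) (v : Point) :
    load (e :: E) v ≤ load E v + (if e.1 = v then 1 else 0) + (if e.2 = v then 1 else 0) := by
  unfold load
  conv_lhs => unfold nbrs
  split_ifs <;> simp

theorem load_cons_le_succ (e : Point × Point) (E : List (Point × Point)) (v : Point) :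
    load (e :: E) v ≤ load E v + 1 := by
  unfold load
  conv_lhs => unfold nbrs
  split_ifs <;> simp

theorem load_cons_of_ne {e : Point × Point} {v : Point} (E : List (Point × Point))
    (h1 : e.1 ≠ v) (h2 : e.2 ≠ v) : load (e :: E) v = load E v := by
  simp [load, nbrs, h1, h2]

theorem load_le_cons (e : Point × Point) (E : List (Point × Point)) (v : Point) :
    load E v ≤ load (e :: E) v := by
  unfold load
  conv_rhs => unfold nbrs
  split_ifs <;> simp

/-- The handshake bound: an edge contributes to the load of at most two points. It limits how many
points can be saturated. -/
theorem sum_load_le (E : List (Point × Point)) (S : Finset Point) :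
    ∑ v ∈ S, load E v ≤ 2 * E.length := by
  induction E with
  | nil => simp [load, nbrs]
  | cons e E ih =>
    calc ∑ v ∈ S, load (e :: E) v
        ≤ ∑ v ∈ S, (load E v + (if e.1 = v then 1 else 0) + (if e.2 = v then 1 else 0)) :=
          Finset.sum_le_sum fun v _ => load_cons_le e E v
      _ = ∑ v ∈ S, load E v + (if e.1 ∈ S then 1 else 0) + (if e.2 ∈ S then 1 else 0) := by
          rw [Finset.sum_add_distrib, Finset.sum_add_distrib, Finset.sum_ite_eq,
            Finset.sum_ite_eq]
      _ ≤ 2 * (e :: E).length := by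
          rw [List.length_cons]
          split_ifs <;> omega

/-- The listed edges and all pairs of points at which fewer than `D` of the edges end. -/
def hull (D : ℕ) (E : List (Point × Point)) : SimpleGraph Point :=
  edgeGraph E ⊔ SimpleGraph.fromRel fun u v => load E u < D ∧ load E v < D

theorem hull_adj {D : ℕ} {E : List (Point × Point)} {u v : Point} :
    (hull D E).Adj u v ↔ (edgeGraph E).Adj u v ∨ (u ≠ v ∧ load E u < D ∧ load E v < D) := by
  simp only [hull, SimpleGraph.sup_adj, SimpleGraph.fromRel_adj]
  tauto

theorem edgeGraph_le_hull (D : ℕ) (E : List (Point × Point)) : edgeGraph E ≤ hull D E :=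
  le_sup_left

/-- `E'` arises from `E` by adding at most one edge, and that between two points at which fewer
than `D` of the edges end. -/
def Extends (D : ℕ) (E E' : List (Point × Point)) : Prop :=
  E' = E ∨ ∃ u v, u ≠ v ∧ load E u < D ∧ load E v < D ∧ E' = (u, v) :: E

theorem edgeGraph_cons_le (u v : Point) (E : List (Point × Point)) :
    edgeGraph E ≤ edgeGraph ((u, v) :: E) := by
  intro x y h
  obtain ⟨hne, h⟩ := (SimpleGraph.fromRel_adj _ _ _).1 h
  exact (SimpleGraph.fromRel_adj _ _ _).2 ⟨hne, h.imp (List.mem_cons_of_mem _)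
    (List.mem_cons_of_mem _)⟩

theorem edgeGraph_cons_adj {u v : Point} (h : u ≠ v) (E : List (Point × Point)) :
    (edgeGraph ((u, v) :: E)).Adj u v :=
  (SimpleGraph.fromRel_adj _ _ _).2 ⟨h, Or.inl List.mem_cons_self⟩

namespace Extends

variable {D : ℕ} {E E' : List (Point × Point)}

theorem edgeGraph_le (h : Extends D E E') : edgeGraph E ≤ edgeGraph E' := by
  obtain rfl | ⟨u, v, -, -, -, rfl⟩ := h
  · exact le_rfl
  · exact edgeGraph_cons_le u v E

theorem load_le (h : Extends D E E') (v : Point) : load E v ≤ load E' v := by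
  obtain rfl | ⟨u, v, -, -, -, rfl⟩ := h
  · exact le_rfl
  · exact load_le_cons _ _ _

theorem length_le (h : Extends D E E') : E'.length ≤ E.length + 1 := by
  obtain rfl | ⟨u, v, -, -, -, rfl⟩ := h <;> simp

theorem load_le_of_load_le (h : Extends D E E') (hE : ∀ v, load E v ≤ D) (v : Point) :
    load E' v ≤ D := by
  obtain rfl | ⟨x, y, -, hx, hy, rfl⟩ := h
  · exact hE v
  · by_cases h1 : x = v
    · subst h1
      exact (load_cons_le_succ _ _ _).trans hx
    · by_cases h2 : y = v
      · subst h2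
        exact (load_cons_le_succ _ _ _).trans hy
      · exact (load_cons_of_ne E h1 h2).trans_le (hE v)

/-- The new edge joins two unsaturated points and so was in the hull before; since loads only grow,
no new free pairs appear. -/
theorem hull_le (h : Extends D E E') : hull D E' ≤ hull D E := by
  intro x y hxy
  rcases hull_adj.1 hxy with hxy | ⟨hne, hx, hy⟩
  · obtain rfl | ⟨u, v, hne, hu, hv, rfl⟩ := h
    · exact edgeGraph_le_hull D _ hxy
    · obtain ⟨hne', hxy⟩ := (SimpleGraph.fromRel_adj _ _ _).1 hxy
      simp only [List.mem_cons, Prod.mk.injEq] at hxy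
      rw [hull_adj]
      rcases hxy with (⟨rfl, rfl⟩ | hxy) | (⟨rfl, rfl⟩ | hxy)
      · exact Or.inr ⟨hne', hu, hv⟩
      · exact Or.inl ((SimpleGraph.fromRel_adj _ _ _).2 ⟨hne', Or.inl hxy⟩)
      · exact Or.inr ⟨hne', hv, hu⟩
      · exact Or.inl ((SimpleGraph.fromRel_adj _ _ _).2 ⟨hne', Or.inr hxy⟩)
  · exact hull_adj.2 (Or.inr ⟨hne, (h.load_le x).trans_lt hx, (h.load_le y).trans_lt hy⟩)

end Extends

/-- A walk in the hull can be replaced by a walk that is not longer and leaves the graph for at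
most one edge. -/
theorem edist_le_length_or_detour {D : ℕ} {E : List (Point × Point)} {x y : Point}
    (p : (hull D E).Walk x y) : (edgeGraph E).edist x y ≤ p.length ∨
      ∃ u v, u ≠ v ∧ load E u < D ∧ load E v < D ∧
        (edgeGraph E).edist x u + 1 + (edgeGraph E).edist v y ≤ p.length := by
  induction p with
  | nil => simp
  | @cons a b c h p ih =>
    rw [SimpleGraph.Walk.length_cons, Nat.cast_add, Nat.cast_one]
    rcases hull_adj.1 h with h | ⟨hne, ha, hb⟩
    · have h1 := SimpleGraph.edist_eq_one_iff_adj.2 h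
      rcases ih with ih | ⟨u, v, huv, hu, hv, ih⟩
      · left
        calc (edgeGraph E).edist a c ≤ (edgeGraph E).edist a b + (edgeGraph E).edist b c :=
              SimpleGraph.edist_triangle
          _ ≤ p.length + 1 := by rw [h1, add_comm]; gcongr
      · refine Or.inr ⟨u, v, huv, hu, hv, ?_⟩
        calc (edgeGraph E).edist a u + 1 + (edgeGraph E).edist v c
            ≤ ((edgeGraph E).edist a b + (edgeGraph E).edist b u) + 1
                + (edgeGraph E).edist v c := by gcongr; exact SimpleGraph.edist_triangle
          _ = ((edgeGraph E).edist b u + 1 + (edgeGraph E).edist v c) + 1 := by rw [h1]; ring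
          _ ≤ p.length + 1 := by gcongr
    -- The step `a, b` leaves the graph. If the rest of the walk does too, by a jump to `v`, then
    -- `a` and `v` are both unsaturated, and a direct jump from `a` to `v` replaces everything in
    -- between.
    · rcases ih with ih | ⟨u, v, huv, hu, hv, ih⟩
      · refine Or.inr ⟨a, b, hne, ha, hb, ?_⟩
        rw [SimpleGraph.edist_self, zero_add, add_comm]
        gcongr
      · have ih' : (edgeGraph E).edist v c ≤ p.length := le_add_self.trans ih
        by_cases hav : a = v
        · subst hav
          exact Or.inl (ih'.trans le_self_add)
        · refine Or.inr ⟨a, v, hav, ha, hv, ?_⟩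
          rw [SimpleGraph.edist_self, zero_add, add_comm]
          gcongr

theorem exists_extends_edist_le (D : ℕ) (E : List (Point × Point)) (x y : Point) :
    ∃ E', Extends D E E' ∧ (edgeGraph E').edist x y ≤ (hull D E).edist x y := by
  by_cases h : (hull D E).edist x y = ⊤
  · exact ⟨E, Or.inl rfl, by simp [h]⟩
  obtain ⟨p, hp⟩ := SimpleGraph.exists_walk_of_edist_ne_top h
  rw [← hp]
  rcases edist_le_length_or_detour p with h | ⟨u, v, huv, hu, hv, h⟩
  · exact ⟨E, Or.inl rfl, h⟩
  · refine ⟨(u, v) :: E, Or.inr ⟨u, v, huv, hu, hv, rfl⟩, le_trans ?_ h⟩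
    set G := edgeGraph ((u, v) :: E) with hG
    have hle : edgeGraph E ≤ G := edgeGraph_cons_le u v E
    have h1 : G.edist u v = 1 := SimpleGraph.edist_eq_one_iff_adj.2 (edgeGraph_cons_adj huv E)
    calc G.edist x y ≤ G.edist x v + G.edist v y := SimpleGraph.edist_triangle
      _ ≤ G.edist x u + G.edist u v + G.edist v y := by gcongr; exact SimpleGraph.edist_triangle
      _ ≤ _ := by
        rw [h1]
        gcongr

/-- The edges after the answer to the query `x, y`: they certify the distance in the hull. -/
noncomputable def extend (D : ℕ) (E : List (Point × Point)) (x y : Point) :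
    List (Point × Point) :=
  (exists_extends_edist_le D E x y).choose

theorem extends_extend (D : ℕ) (E : List (Point × Point)) (x y : Point) :
    Extends D E (extend D E x y) :=
  (exists_extends_edist_le D E x y).choose_spec.1

theorem edist_extend_le (D : ℕ) (E : List (Point × Point)) (x y : Point) :
    (edgeGraph (extend D E x y)).edist x y ≤ (hull D E).edist x y :=
  (exists_extends_edist_le D E x y).choose_spec.2

/-! ## Balls and levels -/

/-- The points within distance `i` from `C` in the graph with edges `E`. -/
def ball (E : List (Point × Point)) (C : Finset Point) : ℕ → Finset Point
  | 0 => C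
  | i + 1 => ball E C i ∪ (ball E C i).biUnion fun v => (nbrs E v).toFinset

theorem ball_subset_succ (E : List (Point × Point)) (C : Finset Point) (i : ℕ) :
    ball E C i ⊆ ball E C (i + 1) :=
  Finset.subset_union_left

theorem ball_mono (E : List (Point × Point)) (C : Finset Point) : Monotone (ball E C) :=
  monotone_nat_of_le_succ (ball_subset_succ E C)

theorem mem_ball_succ_of_adj {E : List (Point × Point)} {C : Finset Point} {i : ℕ} {u v : Point}
    (hu : u ∈ ball E C i) (h : (edgeGraph E).Adj u v) : v ∈ ball E C (i + 1) :=
  Finset.mem_union_right _ (Finset.mem_biUnion.2 ⟨u, hu, by simpa using mem_nbrs_of_adj h⟩)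

theorem card_ball_le {D : ℕ} {E : List (Point × Point)} (hE : ∀ v, load E v ≤ D)
    (C : Finset Point) (i : ℕ) : (ball E C i).card ≤ C.card * (D + 1) ^ i := by
  induction i with
  | zero => simp [ball]
  | succ i ih =>
    have h : ((ball E C i).biUnion fun v => (nbrs E v).toFinset).card ≤ (ball E C i).card * D :=
      Finset.card_biUnion_le_card_mul _ _ _ fun v _ =>
        (List.toFinset_card_le _).trans (hE v)
    calc (ball E C (i + 1)).card ≤ (ball E C i).card + (ball E C i).card * D :=
          (Finset.card_union_le _ _).trans (by gcongr)
      _ = (ball E C i).card * (D + 1) := by ring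
      _ ≤ C.card * (D + 1) ^ i * (D + 1) := by gcongr
      _ = C.card * (D + 1) ^ (i + 1) := by ring

/-- The distance of `v` from `C` in the graph with edges `E`, cut off at `L`. -/
def level (E : List (Point × Point)) (C : Finset Point) (L : ℕ) (v : Point) : ℕ :=
  ((Finset.range L).filter fun i => v ∉ ball E C i).card

theorem level_le (E : List (Point × Point)) (C : Finset Point) (L : ℕ) (v : Point) :
    level E C L v ≤ L :=
  (Finset.card_filter_le _ _).trans (Finset.card_range L).le

theorem level_eq_zero {E : List (Point × Point)} {C : Finset Point} (L : ℕ) {v : Point}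
    (hv : v ∈ C) : level E C L v = 0 := by
  rw [level, Finset.card_eq_zero, Finset.filter_eq_empty_iff]
  intro i _ h
  exact h (ball_mono E C (Nat.zero_le i) hv)

/-- If `v` is missing from the ball of radius `i + 1`, then `u` is missing from that of radius `i`;
shifting the radii costs only the radius 0. -/
theorem level_le_succ_of_adj {E : List (Point × Point)} {C : Finset Point} (L : ℕ) {u v : Point}
    (h : (edgeGraph E).Adj u v) : level E C L v ≤ level E C L u + 1 := by
  have hsub : (Finset.range L).filter (fun i => v ∉ ball E C i) ⊆
      insert 0 (((Finset.range L).filter fun i => u ∉ ball E C i).image (· + 1)) := by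
    intro i hi
    rw [Finset.mem_filter, Finset.mem_range] at hi
    cases i with
    | zero => exact Finset.mem_insert_self _ _
    | succ i =>
      refine Finset.mem_insert_of_mem (Finset.mem_image.2 ⟨i, Finset.mem_filter.2 ⟨?_, ?_⟩, rfl⟩)
      · exact Finset.mem_range.2 (by omega)
      · exact fun hu => hi.2 (mem_ball_succ_of_adj hu h)
  calc level E C L v ≤ _ := Finset.card_le_card hsub
    _ ≤ _ := Finset.card_insert_le _ _
    _ ≤ level E C L u + 1 := by gcongr; exact Finset.card_image_le

theorem mem_ball_of_level_lt {E : List (Point × Point)} {C : Finset Point} {L : ℕ} {v : Point}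
    (h : level E C L v < L) : v ∈ ball E C (L - 1) := by
  by_contra hv
  have : (Finset.range L).filter (fun i => v ∉ ball E C i) = Finset.range L := by
    refine Finset.filter_true_of_mem fun i hi hvi => hv ?_
    exact ball_mono E C (by have := Finset.mem_range.1 hi; omega) hvi
  rw [level, this, Finset.card_range] at h
  exact lt_irrefl _ h

/-! ## The adversary -/

instance : Infinite Point := inferInstanceAs (Infinite ℕ)

/-- The edges that the adversary maintains. -/
noncomputable def edges (D : ℕ) : History → List (Point × Point)
  | [] => []
  | .update _ :: h => edges D h
  | .query x y _ :: h => extend D (edges D h) x y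
  | .output _ :: h => edges D h

theorem active_subset_inserted (h : History) : active h ⊆ inserted h := by
  induction h with
  | nil => exact Finset.Subset.refl _
  | cons e h ih =>
    rcases e with (p | p) | ⟨x, y, r⟩ | o
    · exact Finset.insert_subset_insert _ ih
    · exact (Finset.erase_subset _ _).trans ih
    · exact ih
    · exact ih

theorem load_edges_le (D : ℕ) (h : History) (v : Point) : load (edges D h) v ≤ D := by
  induction h generalizing v with
  | nil => simp [edges, load, nbrs]
  | cons e h ih =>
    rcases e with u | ⟨x, y, r⟩ | o
    · exact ih v
    · exact (extends_extend D _ x y).load_le_of_load_le ih v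
    · exact ih v

/-- The `2 * N` initial insertions have been made, and no current point has `D` edges. -/
def Settled (N D : ℕ) (h : History) : Prop :=
  2 * N ≤ numUpdates h ∧ ∀ p ∈ active h, load (edges D h) p < D

open Classical in
/-- The adversary that inserts `2 * N` points, then deletes current points with `D` edges as long
as there are any. -/
noncomputable def adversary (N D L : ℕ) : Adversary where
  nextUpdate h :=
    if H : 2 * N ≤ numUpdates h ∧ ∃ p ∈ active h, D ≤ load (edges D h) p then
      .del H.2.choose
    -- Fresh among all points ever inserted, so deleted points never return. Once the situation is
    -- settled, this move only serves to keep the stream legal.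
    else .ins (Infinite.exists_notMem_finset (inserted h)).choose
  answer h x y := capDist (hull D (edges D h)) L x y

theorem adversary_nextUpdate (N D L : ℕ) (h : History) :
    (2 * N ≤ numUpdates h ∧ ∃ p ∈ active h, D ≤ load (edges D h) p ∧
      (adversary N D L).nextUpdate h = .del p) ∨
    ((numUpdates h < 2 * N ∨ Settled N D h) ∧ ∃ p ∉ inserted h,
      (adversary N D L).nextUpdate h = .ins p) := by
  by_cases H : 2 * N ≤ numUpdates h ∧ ∃ p ∈ active h, D ≤ load (edges D h) p
  · exact Or.inl ⟨H.1, H.2.choose, H.2.choose_spec.1, H.2.choose_spec.2, dif_pos H⟩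
  · refine Or.inr ⟨?_, _, (Infinite.exists_notMem_finset (inserted h)).choose_spec, dif_neg H⟩
    by_cases h1 : 2 * N ≤ numUpdates h
    · refine Or.inr ⟨h1, fun p hp => ?_⟩
      by_contra h2
      exact H ⟨h1, p, hp, not_lt.1 h2⟩
    · exact Or.inl (not_le.1 h1)

theorem Config.next_cases {A : Algorithm} (𝒜 : Adversary) (c : Config A) :
    (c.busy = false ∧ (c.next 𝒜).busy = true ∧ (c.next 𝒜).time = c.time ∧
      (c.next 𝒜).hist = .update (𝒜.nextUpdate c.hist) :: c.hist) ∨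
    (c.busy = true ∧ (c.next 𝒜).busy = true ∧ (c.next 𝒜).time = c.time + 1 ∧
      ((c.next 𝒜).hist = c.hist ∨
        ∃ x y, (c.next 𝒜).hist = .query x y (𝒜.answer c.hist x y) :: c.hist)) ∨
    (c.busy = true ∧ (c.next 𝒜).busy = false ∧ (c.next 𝒜).time = c.time ∧
      ∃ o, (c.next 𝒜).hist = .output o :: c.hist) := by
  obtain ⟨s, b, h, t⟩ := c
  cases b
  · simp [Config.next]
  · simp only [Config.next]
    rcases A.step s with s' | ⟨x, y, nxt⟩ | o
    · simp
    · by_cases hxy : x ∈ inserted h ∧ y ∈ inserted h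
      · simp [hxy]
      · simp [hxy]
    · simp

/-- All answers in the transcript are distances both in the graph and in its hull. -/
def Certified (D L : ℕ) (h : History) : Prop :=
  ∀ x y r, Event.query x y r ∈ h →
    (capDist (edgeGraph (edges D h)) L x y : ℝ) = r ∧ (capDist (hull D (edges D h)) L x y : ℝ) = r

/-- A sandwich: the old hull distance is at most the new hull distance, which is at most the new
graph distance. The latter is at most the old hull distance for the queried pair by the choice of
`extend`, and at most the old graph distance for earlier pairs. -/
theorem Certified.query {D L : ℕ} {h : History} (hc : Certified D L h) (x y : Point) :
    Certified D L (.query x y (capDist (hull D (edges D h)) L x y) :: h) := by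
  intro x' y' r hr
  change (capDist (edgeGraph (extend D (edges D h) x y)) L x' y' : ℝ) = r ∧
    (capDist (hull D (extend D (edges D h) x y)) L x' y' : ℝ) = r
  have hE := extends_extend D (edges D h) x y
  have h1 := capDist_anti hE.hull_le L x' y'
  have h2 := capDist_anti (edgeGraph_le_hull D (extend D (edges D h) x y)) L x' y'
  rcases List.mem_cons.1 hr with hr | hr
  · simp only [Event.query.injEq] at hr
    obtain ⟨rfl, rfl, rfl⟩ := hr
    have h3 := capDist_le_of_edist_le (L := L) (edist_extend_le D (edges D h) x' y')
    constructor
    · exact_mod_cast le_antisymm h3 (h1.trans h2)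
    · exact_mod_cast le_antisymm (h2.trans h3) h1
  · obtain ⟨h3, rfl⟩ := hc x' y' r hr
    have h3' : capDist (edgeGraph (edges D h)) L x' y' = capDist (hull D (edges D h)) L x' y' := by
      exact_mod_cast h3
    have h4 := capDist_anti hE.edgeGraph_le L x' y'
    constructor
    · exact_mod_cast le_antisymm (h4.trans_eq h3') (h1.trans h2)
    · exact_mod_cast le_antisymm ((h2.trans h4).trans_eq h3') h1

theorem certified_play (A : Algorithm) (N D L m : ℕ) :
    Certified D L (play A (adversary N D L) m).hist := by
  induction m with
  | zero => intro x y r h; simp [play] at h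
  | succ m ih =>
    rw [play]
    rcases Config.next_cases (adversary N D L) (play A (adversary N D L) m) with
      ⟨-, -, -, h⟩ | ⟨-, -, -, h | ⟨x, y, h⟩⟩ | ⟨-, -, -, o, h⟩
    · rw [h]
      intro x y r hr
      exact ih x y r (by simpa using hr)
    · rwa [h]
    · rw [h]
      exact ih.query x y
    · rw [h]
      intro x y r hr
      exact ih x y r (by simpa using hr)

theorem legalStream_play (A : Algorithm) (N D L m : ℕ) :
    LegalStream (play A (adversary N D L) m).hist := by
  induction m with
  | zero => trivial
  | succ m ih =>
    rw [play]
    rcases Config.next_cases (adversary N D L) (play A (adversary N D L) m) with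
      ⟨-, -, -, h⟩ | ⟨-, -, -, h | ⟨x, y, h⟩⟩ | ⟨-, -, -, o, h⟩
    · rw [h]
      rcases adversary_nextUpdate N D L (play A (adversary N D L) m).hist with
        ⟨-, p, hp, -, hu⟩ | ⟨-, p, hp, hu⟩
      · rw [hu]
        exact ⟨hp, ih⟩
      · rw [hu]
        exact ⟨fun h => hp (active_subset_inserted _ h), ih⟩
    · rwa [h]
    · rw [h]
      exact ih
    · rw [h]
      exact ih

/-- On a queried pair the level difference is at most the capped graph distance, which equals the
answer, so taking the maximum changes nothing there. -/
theorem Certified.consistent_levelMetric {D L : ℕ} (hL : 1 ≤ L) {h : History}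
    (hc : Certified D L h) {φ : Point → ℕ} (hφL : ∀ v, φ v ≤ L)
    (hφ : ∀ u v, (edgeGraph (edges D h)).Adj u v → φ v ≤ φ u + 1) :
    Consistent (levelMetric (hull D (edges D h)) L hL φ) h := by
  intro x y r hr
  obtain ⟨h1, h2⟩ := hc x y r hr
  change max (capDist (hull D (edges D h)) L x y : ℝ) |(φ x : ℝ) - φ y| = r
  rw [h2, max_eq_left]
  rw [← h1, abs_le]
  have h3 := le_add_capDist hφL hφ x y
  have h4 := le_add_capDist hφL hφ y x
  rw [capDist_comm] at h4
  rify at h3 h4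
  constructor <;> linarith

theorem isMetricAdaptive_adversary (N D : ℕ) {L : ℕ} (hL : 1 ≤ L) :
    (adversary N D L).IsMetricAdaptive := fun A m =>
  ⟨legalStream_play A N D L m, _, (certified_play A N D L m).consistent_levelMetric hL
    (φ := fun _ => 0) (fun _ => Nat.zero_le _) fun _ _ _ => Nat.zero_le _⟩

/-! ## The course of the game -/

/-- Each operation takes two moves that cost no time, its arrival and its report; `busy` accounts
for a report still due. Bounds on time and on operations therefore bound the length of the play. -/
theorem add_busy_play (A : Algorithm) (𝒜 : Adversary) (m : ℕ) :
    m + (play A 𝒜 m).busy.toNat = (play A 𝒜 m).time + 2 * numUpdates (play A 𝒜 m).hist := by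
  induction m with
  | zero => simp [play, numUpdates]
  | succ m ih =>
    rw [play]
    rcases Config.next_cases 𝒜 (play A 𝒜 m) with
      ⟨hb, hb', ht, h⟩ | ⟨hb, hb', ht, h | ⟨x, y, h⟩⟩ | ⟨hb, hb', ht, o, h⟩ <;>
    · rw [hb] at ih
      rw [hb', ht, h]
      simp only [numUpdates, Bool.toNat_true, Bool.toNat_false] at ih ⊢
      omega

theorem hist_of_not_busy (A : Algorithm) (𝒜 : Adversary) (m : ℕ)
    (hb : (play A 𝒜 m).busy = false) :
    (play A 𝒜 m).hist = [] ∨ ∃ o h, (play A 𝒜 m).hist = .output o :: h := by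
  cases m with
  | zero => exact Or.inl rfl
  | succ m =>
    rw [play] at hb ⊢
    rcases Config.next_cases 𝒜 (play A 𝒜 m) with
      ⟨-, hb', -⟩ | ⟨-, hb', -⟩ | ⟨-, -, -, o, h⟩
    · simp [hb'] at hb
    · simp [hb'] at hb
    · exact Or.inr ⟨o, _, h⟩

/-- What holds until the first report in a settled situation. -/
structure Unsettled (N D : ℕ) (h : History) (t : ℕ) : Prop where
  length_edges : (edges D h).length ≤ t
  card_inserted : (inserted h).card = min (numUpdates h) (2 * N)
  card_active : numUpdates h + (active h).card = 2 * (inserted h).card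
  load_eq : ∀ p ∈ inserted h, p ∉ active h → D ≤ load (edges D h) p
  peak_le : peak h ≤ 2 * N

/-- Until a settled report, the stream is `2 * N` insertions of fresh points followed by deletions
of saturated ones. With `i` insertions and `d` deletions there are `i + d` operations and `i - d`
current points, whence `card_active`. -/
theorem unsettled_play (A : Algorithm) {N D L : ℕ} (hN : 1 ≤ N) (m : ℕ)
    (hm : ∀ m' < m, ∀ o h, (play A (adversary N D L) m').hist = .output o :: h →
      ¬ Settled N D h) :
    Unsettled N D (play A (adversary N D L) m).hist (play A (adversary N D L) m).time := by
  induction m with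
  | zero =>
    exact ⟨by simp [play, edges], by simp [play, inserted, numUpdates],
      by simp [play, inserted, numUpdates, active], by simp [play, inserted], by simp [play, peak]⟩
  | succ m ih =>
    have ih := ih fun m' hm' => hm m' (by omega)
    -- The adversary moves only at the start, where `2 * N ≤ 0` fails, or right after a report,
    -- which is not settled by assumption.
    have hset : (play A (adversary N D L) m).busy = false →
        ¬ Settled N D (play A (adversary N D L) m).hist := by
      intro hb
      rcases hist_of_not_busy A _ m hb with h | ⟨o, h, hh⟩
      · rw [h]
        intro hs
        have := hs.1
        simp only [numUpdates] at this
        omega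
      · rw [hh]
        exact hm m (by omega) o h hh
    rw [play]
    set c := play A (adversary N D L) m
    have hact : (active c.hist).card ≤ (inserted c.hist).card :=
      Finset.card_le_card (active_subset_inserted _)
    rcases Config.next_cases (adversary N D L) c with
      ⟨hb, -, ht, h⟩ | ⟨-, -, ht, h | ⟨x, y, h⟩⟩ | ⟨-, -, ht, o, h⟩
    · rw [h, ht]
      obtain ⟨i1, i2, i3, i4, i5⟩ := ih
      rcases adversary_nextUpdate N D L c.hist with ⟨hn, p, hp, hd, hu⟩ | ⟨hn, p, hp, hu⟩
      · rw [hu]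
        have hc := Finset.card_erase_add_one hp
        refine ⟨i1, ?_, ?_, ?_, ?_⟩
        · simp only [inserted, numUpdates]
          omega
        · simp only [inserted, numUpdates, active]
          omega
        · intro q hq hq'
          simp only [active, Finset.mem_erase, not_and_or, not_not] at hq'
          rcases hq' with rfl | hq'
          · exact hd
          · exact i4 q hq hq'
        · simp only [peak, active]
          omega
      · have hn := hn.resolve_right (hset hb)
        rw [hu]
        have hp' : p ∉ active c.hist := fun h => hp (active_subset_inserted _ h)
        have hc := Finset.card_insert_of_notMem hp
        have hc' := Finset.card_insert_of_notMem hp'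
        refine ⟨i1, ?_, ?_, ?_, ?_⟩
        · simp only [inserted, numUpdates]
          omega
        · simp only [inserted, numUpdates, active]
          omega
        · intro q hq hq'
          simp only [active, inserted, Finset.mem_insert, not_or] at hq hq'
          exact i4 q (hq.resolve_left hq'.1) hq'.2
        · simp only [peak, active]
          omega
    · rw [h, ht]
      exact ⟨ih.1.trans (Nat.le_succ _), ih.2, ih.3, ih.4, ih.5⟩
    · rw [h, ht]
      have hE := extends_extend D (edges D c.hist) x y
      refine ⟨hE.length_le.trans (Nat.succ_le_succ ih.1), ih.2, ih.3,
        fun p hp hp' => (ih.4 p hp hp').trans (hE.load_le p), ?_⟩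
      have := ih.2
      have := ih.5
      simp only [peak, active]
      omega
    · rw [h, ht]
      refine ⟨ih.1, ih.2, ih.3, ih.4, ?_⟩
      have := ih.2
      have := ih.5
      simp only [peak, active]
      omega

theorem Unsettled.numUpdates_le {N D t : ℕ} {h : History} (H : Unsettled N D h t) :
    numUpdates h ≤ 4 * N := by
  have h1 := H.card_inserted
  have h2 := H.card_active
  omega

theorem Unsettled.time_le {A : Algorithm} {N D L : ℕ} {f : ℕ → ℝ} (hf : Monotone f)
    (hA : HasUpdateTime A (adversary N D L) f) {m : ℕ}
    (H : Unsettled N D (play A (adversary N D L) m).hist (play A (adversary N D L) m).time) :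
    ((play A (adversary N D L) m).time : ℝ) ≤ 4 * N * max 2 (f (2 * N)) := by
  refine (hA m).trans (mul_le_mul_of_nonneg ?_ ?_ (by positivity) (by positivity))
  · exact_mod_cast H.numUpdates_le
  · exact (hf H.peak_le).trans (le_max_right _ _)

theorem exists_settled_output {A : Algorithm} {N D L : ℕ} (hN : 1 ≤ N) {f : ℕ → ℝ}
    (hf : Monotone f) (hD : 8 * max 2 (f (2 * N)) ≤ D)
    (hA : HasUpdateTime A (adversary N D L) f) :
    ∃ m o h, (play A (adversary N D L) m).hist = .output o :: h ∧ Settled N D h ∧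
      N ≤ (active h).card ∧ (active h).card ≤ 2 * N := by
  classical
  have hex : ∃ m, ∃ o h, (play A (adversary N D L) m).hist = .output o :: h ∧ Settled N D h := by
    by_contra hno
    -- Without a settled report the play has at most `4 * N` operations, hence at most `4 * N * max
    -- 2 (f (2 * N))` units of time and `8 * N` further moves.
    obtain ⟨m, hm⟩ := exists_nat_gt (4 * N * max 2 (f (2 * N)) + 8 * N)
    have H := unsettled_play A (D := D) (L := L) hN m
      fun m' _ o h hh hs => hno ⟨m', o, h, hh, hs⟩
    have h1 := H.time_le hf hA
    have h2 := H.numUpdates_le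
    have h3 := add_busy_play A (adversary N D L) m
    rify at h2 h3
    have h4 : (0 : ℝ) ≤ (play A (adversary N D L) m).busy.toNat := Nat.cast_nonneg _
    linarith
  obtain ⟨o, h, hh, hs⟩ := Nat.find_spec hex
  set m := Nat.find hex
  have H := unsettled_play A (D := D) (L := L) hN m
    fun m' hm' o h hh hs => Nat.find_min hex hm' ⟨o, h, hh, hs⟩
  have ht := H.time_le hf hA
  rw [hh] at H
  refine ⟨m, o, h, hh, hs, ?_⟩
  have h1 : (edges D h).length ≤ (play A (adversary N D L) m).time := H.length_edges
  have h2 : (inserted h).card = min (numUpdates h) (2 * N) := H.card_inserted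
  have h3 := hs.1
  have h4 : D * (inserted h \ active h).card ≤ 2 * (edges D h).length := by
    refine le_trans ?_ (sum_load_le (edges D h) (inserted h \ active h))
    rw [mul_comm, ← smul_eq_mul]
    refine Finset.card_nsmul_le_sum _ _ _ fun p hp => ?_
    rw [Finset.mem_sdiff] at hp
    exact H.load_eq p hp.1 hp.2
  have h5 := Finset.card_sdiff_add_card_eq_card (active_subset_inserted h)
  -- With `F` for the time bound, each deleted point absorbs `D ≥ 8 * F` of a total load of at most
  -- `2 * (4 * N * F)`.
  have h6 : (inserted h \ active h).card ≤ N := by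
    have hF : (2 : ℝ) ≤ max 2 (f (2 * N)) := le_max_left _ _
    set F := max 2 (f (2 * N))
    rify at h1 h4
    by_contra hlt
    have hlt : (N : ℝ) < (inserted h \ active h).card := by exact_mod_cast not_le.1 hlt
    have : (8 * F) * N < D * (inserted h \ active h).card := by
      calc (8 * F) * N < (8 * F) * (inserted h \ active h).card := by gcongr
        _ ≤ _ := by gcongr
    linarith
  omega

/-- In a settled situation, every set `C` is far from most points in some consistent metric, and
points at the same level are close to each other. -/
theorem exists_consistent_level {A : Algorithm} {N D L m : ℕ} (hL : 1 ≤ L) {o : Output}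
    {h : History} (hh : (play A (adversary N D L) m).hist = .output o :: h)
    (hs : Settled N D h) (C : Finset Point) :
    ∃ (φ : Point → ℕ) (M : MetricSpace Point), Consistent M h ∧ (∀ v, φ v ≤ L) ∧
      (∀ v ∈ C, φ v = 0) ∧
      ((active h).filter fun v => φ v < L).card ≤ C.card * (D + 1) ^ (L - 1) ∧
      (∀ u v, |(φ u : ℝ) - φ v| ≤ dist u v) ∧
      (∀ u ∈ active h, ∀ v ∈ active h, dist u v ≤ max 1 |(φ u : ℝ) - φ v|) := by
  have hc : Certified D L h := by
    have := certified_play A N D L m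
    rw [hh] at this
    exact fun x y r hr => this x y r (List.mem_cons_of_mem _ hr)
  refine ⟨level (edges D h) C L, levelMetric (hull D (edges D h)) L hL _,
    hc.consistent_levelMetric hL (level_le _ _ _) fun u v huv => level_le_succ_of_adj L huv,
    level_le _ _ _, fun v hv => level_eq_zero L hv, ?_, fun u v => le_max_right _ _, ?_⟩
  · refine le_trans (Finset.card_le_card fun v hv => ?_)
      (card_ball_le (load_edges_le D h) C (L - 1))
    exact mem_ball_of_level_lt (Finset.mem_filter.1 hv).2
  · intro u hu v hv
    refine max_le_max_right _ ?_
    by_cases huv : u = v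
    · simp [huv, capDist_self]
    · exact_mod_cast capDist_le_one_of_adj L
        -- Settledness enters here: current points are unsaturated, hence adjacent in the hull.
        (hull_adj.2 (Or.inr ⟨huv, hs.2 u hu, hs.2 v hv⟩))

/-! ## Costs in the hard instances -/

/-- Every set `C` of points is at distance `L` from all but `C.card * K` current points in some
consistent metric given by levels: points at the same or adjacent levels are close. -/
def Separated (h : History) (L K : ℕ) : Prop :=
  ∀ C : Finset Point, ∃ (φ : Point → ℕ) (M : MetricSpace Point), Consistent M h ∧
    (∀ v, φ v ≤ L) ∧ (∀ v ∈ C, φ v = 0) ∧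
    ((active h).filter fun v => φ v < L).card ≤ C.card * K ∧
    (∀ u v, |(φ u : ℝ) - φ v| ≤ dist u v) ∧
    (∀ u ∈ active h, ∀ v ∈ active h, dist u v ≤ max 1 |(φ u : ℝ) - φ v|)

theorem exists_level_eq {P : Finset Point} {φ : Point → ℕ} {L b : ℕ} (hφL : ∀ v, φ v ≤ L)
    (hb : (P.filter fun v => φ v < L).card ≤ b) (hP : b < P.card) : ∃ p ∈ P, φ p = L := by
  by_contra! hno
  rw [Finset.filter_true_of_mem fun p hp => (hφL p).lt_of_ne (hno p hp)] at hb
  omega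

theorem centerObj_nonneg (M : MetricSpace Point) (P C : Finset Point) (l : Point → Point) :
    0 ≤ centerObj M P C l :=
  NNReal.coe_nonneg _

theorem powerObj_nonneg (z : ℝ) (M : MetricSpace Point) (P C : Finset Point)
    (l : Point → Point) : 0 ≤ powerObj z M P C l :=
  Finset.sum_nonneg fun _ _ => Real.rpow_nonneg dist_nonneg _

theorem radiiObj_nonneg (M : MetricSpace Point) (P C : Finset Point) (l : Point → Point) :
    0 ≤ radiiObj M P C l :=
  Finset.sum_nonneg fun _ _ => NNReal.coe_nonneg _

theorem diamObj_nonneg (M : MetricSpace Point) (P C : Finset Point) (l : Point → Point) :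
    0 ≤ diamObj M P C l :=
  Finset.sum_nonneg fun _ _ => Metric.diam_nonneg

section Costs

variable {obj : Objective} {M : MetricSpace Point} {P C : Finset Point}

theorem optCost_nonneg (hobj : ∀ M P C l, 0 ≤ obj M P C l) (k : ℕ) : 0 ≤ optCost obj k M P := by
  refine Real.sInf_nonneg ?_
  rintro _ ⟨C, -, -, l, -, rfl⟩
  exact hobj _ _ _ _

theorem optCost_le (hobj : ∀ M P C l, 0 ≤ obj M P C l) {k : ℕ} (hCP : C ⊆ P) (hC : C.card ≤ k)
    {l : Point → Point} (hl : ∀ p ∈ P, l p ∈ C) : optCost obj k M P ≤ obj M P C l := by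
  refine csInf_le ⟨0, ?_⟩ ⟨C, hCP, hC, l, hl, rfl⟩
  rintro _ ⟨C, -, -, l, -, rfl⟩
  exact hobj _ _ _ _

theorem le_costOf (hC : C.Nonempty) {r : ℝ}
    (h : ∀ l : Point → Point, (∀ p ∈ P, l p ∈ C) → r ≤ obj M P C l) : r ≤ costOf obj M P C := by
  obtain ⟨c, hc⟩ := hC
  refine le_csInf ⟨_, fun _ => c, fun _ _ => hc, rfl⟩ ?_
  rintro _ ⟨l, hl, rfl⟩
  exact h l hl

theorem le_optCost_one (hP : P.Nonempty) {r : ℝ}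
    (h : ∀ c ∈ P, ∀ l : Point → Point, (∀ p ∈ P, l p = c) → r ≤ obj M P {c} l) :
    r ≤ optCost obj 1 M P := by
  obtain ⟨p, hp⟩ := hP
  refine le_csInf ⟨_, {p}, by simpa using hp, by simp, fun _ => p, by simp, rfl⟩ ?_
  rintro _ ⟨C, hCP, hC, l, hl, rfl⟩
  obtain ⟨c, rfl⟩ := Finset.card_eq_one.1
    (le_antisymm hC (Finset.card_pos.2 ⟨_, hl p hp⟩))
  exact h c (by simpa using hCP) l fun q hq => by simpa using hl q hq

end Costs

/-- The levels `0, ..., L` fall into at most `k` pairs `2 * j, 2 * j + 1`. One representative per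
nonempty pair covers it with radius 1, whereas some point at level `L` is far from all of `C`. -/
theorem Separated.center {h : History} {L K k g : ℕ} (hs : Separated h L K) (hLk : L + 1 ≤ 2 * k)
    (hK : g * K < (active h).card) {C : Finset Point} (hC : C.Nonempty) (hCg : C.card ≤ g) :
    ∃ M : MetricSpace Point, Consistent M h ∧ (L : ℝ) ≤ costOf centerObj M (active h) C ∧
      optCost centerObj k M (active h) ≤ 1 := by
  classical
  obtain ⟨φ, M, hM, hφL, hφC, hb, hlow, hup⟩ := hs C
  set P := active h
  refine ⟨M, hM, le_costOf hC fun l hl => ?_, ?_⟩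
  · obtain ⟨p, hp, hpL⟩ := exists_level_eq hφL hb
      ((Nat.mul_le_mul_right K hCg).trans_lt hK)
    have h1 := hlow p (l p)
    rw [hpL, hφC _ (hl p hp), Nat.cast_zero, sub_zero, abs_of_nonneg (Nat.cast_nonneg _)] at h1
    refine h1.trans ?_
    have h2 : nndist p (l p) ≤ P.sup fun p => nndist p (l p) :=
      Finset.le_sup (f := fun p => nndist p (l p)) hp
    exact_mod_cast h2
  · have hr : ∀ j, ∃ q, ∀ p ∈ P, φ p / 2 = j → q ∈ P ∧ φ q / 2 = j := by
      intro j
      by_cases hj : ∃ p ∈ P, φ p / 2 = j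
      · obtain ⟨q, hq, hqj⟩ := hj
        exact ⟨q, fun _ _ _ => ⟨hq, hqj⟩⟩
      -- A dummy value for pairs of levels without points.
      · obtain ⟨q, -⟩ := hC
        exact ⟨q, fun p hp hpj => (hj ⟨p, hp, hpj⟩).elim⟩
    choose r hr using hr
    have hsub : P.image (fun p => r (φ p / 2)) ⊆ (Finset.range k).image r := by
      intro q hq
      obtain ⟨p, -, rfl⟩ := Finset.mem_image.1 hq
      refine Finset.mem_image_of_mem _ (Finset.mem_range.2 ?_)
      have := hφL p
      omega
    refine (optCost_le centerObj_nonneg (C := P.image fun p => r (φ p / 2)) ?_ ?_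
      (l := fun p => r (φ p / 2)) fun p hp => Finset.mem_image_of_mem _ hp).trans ?_
    · intro q hq
      obtain ⟨p, hp, rfl⟩ := Finset.mem_image.1 hq
      exact (hr _ p hp rfl).1
    · exact (Finset.card_le_card hsub).trans (Finset.card_image_le.trans_eq (Finset.card_range k))
    · have : (P.sup fun p => nndist p (r (φ p / 2))) ≤ 1 := by
        refine Finset.sup_le fun p hp => ?_
        obtain ⟨h1, h2⟩ := hr _ p hp rfl
        have h3 : |(φ p : ℝ) - φ (r (φ p / 2))| ≤ 1 := by
          generalize φ (r (φ p / 2)) = y at h2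
          have h4 : φ p ≤ y + 1 := by omega
          have h5 : y ≤ φ p + 1 := by omega
          rify at h4 h5
          rw [abs_le]
          constructor <;> linarith
        have h4 := hup p hp _ h1
        rw [max_eq_left h3] at h4
        exact_mod_cast h4
      exact_mod_cast this

/-- All but `b` points have level `L` and pay at least `L ^ z` to reach `C`. A single center at
level `L` serves them at distance at most 1, and the other points at distance at most `L`. -/
theorem Separated.power {h : History} {L K g b : ℕ} (hs : Separated h L K) (hL : 1 ≤ L)
    (hb : g * K ≤ b) (hbP : b < (active h).card) {z : ℝ} (hz : 0 < z)
    {C : Finset Point} (hC : C.Nonempty) (hCg : C.card ≤ g) :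
    ∃ M : MetricSpace Point, Consistent M h ∧
      ((active h).card - b : ℝ) * (L : ℝ) ^ z ≤ costOf (powerObj z) M (active h) C ∧
      optCost (powerObj z) 1 M (active h) ≤ (active h).card + b * (L : ℝ) ^ z := by
  obtain ⟨φ, M, hM, hφL, hφC, hbC, hlow, hup⟩ := hs C
  set P := active h
  replace hbC : (P.filter fun v => φ v < L).card ≤ b :=
    hbC.trans ((Nat.mul_le_mul_right K hCg).trans hb)
  have hLz : (0 : ℝ) ≤ (L : ℝ) ^ z := Real.rpow_nonneg (Nat.cast_nonneg _) _
  have hL' : (1 : ℝ) ≤ L := by exact_mod_cast hL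
  refine ⟨M, hM, le_costOf hC fun l hl => ?_, ?_⟩
  · have hcard := Finset.card_filter_add_card_filter_not (s := P) fun v => φ v < L
    have hcard' : (P.card : ℝ) - b ≤ (P.filter fun v => ¬ φ v < L).card := by
      have : P.card ≤ (P.filter fun v => ¬ φ v < L).card + b := by omega
      have := (Nat.cast_le (α := ℝ)).2 this
      rw [Nat.cast_add] at this
      linarith
    calc (P.card - b : ℝ) * (L : ℝ) ^ z
        ≤ (P.filter fun v => ¬ φ v < L).card * (L : ℝ) ^ z := by gcongr
      _ = ∑ p ∈ P.filter (fun v => ¬ φ v < L), (L : ℝ) ^ z := by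
          rw [Finset.sum_const, nsmul_eq_mul]
      _ ≤ ∑ p ∈ P.filter (fun v => ¬ φ v < L), dist p (l p) ^ z := by
          refine Finset.sum_le_sum fun p hp => ?_
          obtain ⟨hp, hpL⟩ := Finset.mem_filter.1 hp
          have h1 := hlow p (l p)
          rw [le_antisymm (hφL p) (not_lt.1 hpL), hφC _ (hl p hp), Nat.cast_zero, sub_zero,
            abs_of_nonneg (Nat.cast_nonneg _)] at h1
          exact Real.rpow_le_rpow (Nat.cast_nonneg _) h1 hz.le
      _ ≤ ∑ p ∈ P, dist p (l p) ^ z :=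
          Finset.sum_le_sum_of_subset_of_nonneg (Finset.filter_subset _ _)
            fun _ _ _ => Real.rpow_nonneg dist_nonneg _
  · obtain ⟨q, hq, hqL⟩ := exists_level_eq hφL hbC hbP
    refine (optCost_le (powerObj_nonneg z) (C := {q}) (by simpa using hq) (by simp)
      (l := fun _ => q) (by simp)).trans ?_
    calc ∑ p ∈ P, dist p q ^ z
        ≤ ∑ p ∈ P, (1 + if φ p < L then (L : ℝ) ^ z else 0) := by
          refine Finset.sum_le_sum fun p hp => ?_
          have h1 := hup p hp q hq
          split_ifs with hpL
          · have h2 : dist p q ≤ L := by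
              refine h1.trans (max_le hL' ?_)
              have h3 : (φ p : ℝ) ≤ L := by exact_mod_cast hφL p
              have h4 : (0 : ℝ) ≤ φ p := Nat.cast_nonneg _
              rw [hqL, abs_le]
              constructor <;> linarith
            have := Real.rpow_le_rpow dist_nonneg h2 hz.le
            linarith
          · rw [hqL, le_antisymm (hφL p) (not_lt.1 hpL), sub_self, abs_zero,
              max_eq_left zero_le_one] at h1
            have := Real.rpow_le_one dist_nonneg h1 hz.le
            linarith
      _ = P.card + (P.filter fun v => φ v < L).card * (L : ℝ) ^ z := by
          rw [Finset.sum_add_distrib, ← Finset.sum_filter, Finset.sum_const, Finset.sum_const,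
            nsmul_eq_mul, nsmul_eq_mul, mul_one]
      _ ≤ P.card + b * (L : ℝ) ^ z := by gcongr

/-- An objective that, for a single cluster, is comparable to the diameter of the point set. -/
structure DiameterLike (obj : Objective) : Prop where
  nonneg : ∀ M P C l, 0 ≤ obj M P C l
  le_one : ∀ (M : MetricSpace Point) (P : Finset Point), ∀ c ∈ P,
    (∀ u ∈ P, ∀ v ∈ P, dist u v ≤ 1) → obj M P {c} (fun _ => c) ≤ 1
  half_dist_le : ∀ (M : MetricSpace Point) (P : Finset Point) (c : Point) (l : Point → Point),
    (∀ p ∈ P, l p = c) → ∀ u ∈ P, ∀ v ∈ P, dist u v / 2 ≤ obj M P {c} l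

theorem sup_nndist_le_one (M : MetricSpace Point) (P : Finset Point) {c : Point} (hc : c ∈ P)
    (h : ∀ u ∈ P, ∀ v ∈ P, dist u v ≤ 1) : ((P.sup fun p => nndist p c : ℝ≥0) : ℝ) ≤ 1 := by
  have : (P.sup fun p => nndist p c) ≤ 1 :=
    Finset.sup_le fun p hp => by exact_mod_cast h p hp c hc
  exact_mod_cast this

theorem half_dist_le_sup_nndist (M : MetricSpace Point) (P : Finset Point) (c : Point)
    {u v : Point} (hu : u ∈ P) (hv : v ∈ P) :
    dist u v / 2 ≤ ((P.sup fun p => nndist p c : ℝ≥0) : ℝ) := by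
  have h : ∀ w ∈ P, dist w c ≤ ((P.sup fun p => nndist p c : ℝ≥0) : ℝ) := fun w hw => by
    have : nndist w c ≤ P.sup fun p => nndist p c := Finset.le_sup (f := fun p => nndist p c) hw
    exact_mod_cast this
  have h1 := dist_triangle_right u v c
  linarith [h u hu, h v hv]

theorem diameterLike_centerObj : DiameterLike centerObj where
  nonneg := centerObj_nonneg
  le_one M P c hc h := sup_nndist_le_one M P hc h
  half_dist_le M P c l hl u hu v hv := by
    have : (P.sup fun p => nndist p (l p)) = P.sup fun p => nndist p c :=
      Finset.sup_congr rfl fun p hp => by rw [hl p hp]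
    rw [centerObj, this]
    exact half_dist_le_sup_nndist M P c hu hv

theorem diameterLike_radiiObj : DiameterLike radiiObj where
  nonneg := radiiObj_nonneg
  le_one M P c hc h := by
    simpa [radiiObj] using sup_nndist_le_one M P hc h
  half_dist_le M P c l hl u hu v hv := by
    simpa [radiiObj, Finset.filter_true_of_mem hl] using half_dist_le_sup_nndist M P c hu hv

theorem diameterLike_diamObj : DiameterLike diamObj where
  nonneg := diamObj_nonneg
  le_one M P c hc h := by
    rw [diamObj, Finset.sum_singleton]
    exact Metric.diam_le_of_forall_dist_le zero_le_one fun u hu v hv => h u hu.1 v hv.1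
  half_dist_le M P c l hl u hu v hv := by
    rw [diamObj, Finset.sum_singleton]
    have hb : Bornology.IsBounded {p : Point | p ∈ P ∧ l p = c} :=
      (P.finite_toSet.subset fun p hp => hp.1).isBounded
    have h1 := Metric.dist_le_diam_of_mem hb ⟨hu, hl u hu⟩ ⟨hv, hl v hv⟩
    have h2 : 0 ≤ dist u v := dist_nonneg
    linarith

/-- For `C = ∅` no point lies below level `L`, so all levels agree. -/
theorem Separated.exists_optCost_le_one {h : History} {L K : ℕ} (hs : Separated h L K)
    (hP : (active h).Nonempty) {obj : Objective} (hobj : DiameterLike obj) :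
    ∃ M : MetricSpace Point, Consistent M h ∧ optCost obj 1 M (active h) ≤ 1 := by
  obtain ⟨φ, M, hM, hφL, -, hb, -, hup⟩ := hs ∅
  rw [Finset.card_empty, zero_mul, Nat.le_zero, Finset.card_eq_zero,
    Finset.filter_eq_empty_iff] at hb
  have hφ : ∀ u ∈ active h, φ u = L := fun u hu => le_antisymm (hφL u) (not_lt.1 (hb hu))
  obtain ⟨p, hp⟩ := hP
  refine ⟨M, hM, (optCost_le hobj.nonneg (C := {p}) (by simpa using hp) (by simp)
    (l := fun _ => p) (by simp)).trans (hobj.le_one M _ p hp fun u hu v hv => ?_)⟩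
  simpa [hφ u hu, hφ v hv] using hup u hu v hv

/-- For `C = {p}` some current point is at distance at least `L` from `p`. -/
theorem Separated.exists_le_optCost {h : History} {L K : ℕ} (hs : Separated h L K)
    (hK : K < (active h).card) {obj : Objective} (hobj : DiameterLike obj) :
    ∃ M : MetricSpace Point, Consistent M h ∧ (L : ℝ) / 2 ≤ optCost obj 1 M (active h) := by
  obtain ⟨p, hp⟩ : (active h).Nonempty := Finset.card_pos.1 (Nat.zero_lt_of_lt hK)
  obtain ⟨φ, M, hM, hφL, hφC, hb, hlow, -⟩ := hs {p}
  rw [Finset.card_singleton, one_mul] at hb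
  obtain ⟨q, hq, hqL⟩ := exists_level_eq hφL hb hK
  refine ⟨M, hM, le_optCost_one ⟨p, hp⟩ fun c _ l hl => ?_⟩
  refine le_trans ?_ (hobj.half_dist_le M _ c l hl q hq p hp)
  have h1 := hlow q p
  rw [hqL, hφC p (by simp), Nat.cast_zero, sub_zero, abs_of_nonneg (Nat.cast_nonneg _)] at h1
  linarith

/-! ## From separated instances to lower bounds -/

/-- The degree bound that the adversary uses at scale `N` against update time `f`. -/
noncomputable def degreeBound (f : ℕ → ℝ) (N : ℕ) : ℕ := ⌈8 * max 2 (f (2 * N))⌉₊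

theorem exists_separated_output {f : ℕ → ℝ} (hf : Monotone f) {N L : ℕ} (hN : 1 ≤ N)
    (hL : 1 ≤ L) {A : Algorithm}
    (hA : HasUpdateTime A (adversary N (degreeBound f N) L) f) :
    ∃ m o h, (play A (adversary N (degreeBound f N) L) m).hist = .output o :: h ∧
      N ≤ (active h).card ∧ (active h).card ≤ 2 * N ∧
      Separated h L ((degreeBound f N + 1) ^ (L - 1)) := by
  obtain ⟨m, o, h, hh, hs, h1, h2⟩ := exists_settled_output hN hf (Nat.le_ceil _) hA
  exact ⟨m, o, h, hh, h1, h2, exists_consistent_level hL hh hs⟩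

theorem centersLowerBound_of_separated {obj : Objective} (hobj : ∀ M P C l, 0 ≤ obj M P C l)
    {k g : ℕ} {f bound : ℕ → ℝ} (hf : Monotone f)
    (H : ∀ N, g < N → ∃ L, 1 ≤ L ∧ ∀ h, N ≤ (active h).card → (active h).card ≤ 2 * N →
      Separated h L ((degreeBound f N + 1) ^ (L - 1)) →
      ∀ C : Finset Point, C.Nonempty → C.card ≤ g →
        ∃ M : MetricSpace Point, Consistent M h ∧ ∃ q : ℝ, 0 < q ∧
          optCost obj k M (active h) ≤ q ∧ 0 < costOf obj M (active h) C ∧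
          bound (active h).card * q ≤ costOf obj M (active h) C) :
    CentersLowerBound obj k g f bound := by
  intro N hN
  obtain ⟨L, hL, H⟩ := H N hN
  refine ⟨_, isMetricAdaptive_adversary N (degreeBound f N) hL, fun A hA hO α hα => ?_⟩
  obtain ⟨m, o, h, hh, h1, h2, hs⟩ := exists_separated_output hf (by omega) hL hA
  have hP : (active h).Nonempty := Finset.card_pos.1 (by omega)
  obtain ⟨-, hOg, hOne⟩ := hO m o h hh
  obtain ⟨M, hM, q, hq, hopt, hpos, hb⟩ := H h h1 h2 hs o.centers (hOne hP) hOg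
  refine ⟨(active h).card, h1, by omega, ?_⟩
  have h3 := hα m o h hh hP M hM
  have h4 := optCost_nonneg (M := M) (P := active h) hobj k
  -- No sign of `α` is assumed; the positive cost forces it, which permits replacing the optimum by
  -- its upper bound `q`.
  have h5 : 0 < α (active h).card := pos_of_mul_pos_left (hpos.trans_le h3) h4
  have h6 := mul_le_mul_of_nonneg_left hopt h5.le
  exact le_of_mul_le_mul_right (hb.trans (h3.trans h6)) hq

theorem estimateLowerBound_of_separated {obj : Objective} (hobj : DiameterLike obj)
    {f bound : ℕ → ℝ} (hf : Monotone f)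
    (H : ∀ N, 2 ≤ N → ∃ L : ℕ, 1 ≤ L ∧ (degreeBound f N + 1) ^ (L - 1) < N ∧
      ∀ n, N ≤ n → n ≤ 2 * N → bound n ≤ L / 2) :
    EstimateLowerBound obj 1 f bound := by
  intro N hN
  obtain ⟨L, hL, hK, H⟩ := H N hN
  refine ⟨_, isMetricAdaptive_adversary N (degreeBound f N) hL, fun A hA α hα => ?_⟩
  obtain ⟨m, o, h, hh, h1, h2, hs⟩ := exists_separated_output hf (by omega) hL hA
  have hP : (active h).Nonempty := Finset.card_pos.1 (by omega)
  refine ⟨(active h).card, h1, by omega, (H _ h1 h2).trans ?_⟩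
  obtain ⟨M, hM, hopt⟩ := hs.exists_optCost_le_one hP hobj
  obtain ⟨M', hM', hopt'⟩ := hs.exists_le_optCost (hK.trans_le h1) hobj
  -- One and the same estimate must be at least the optimum for `M'` and at most `α` times the
  -- optimum for `M`.
  have h3 := hopt'.trans ((hα m o h hh hP M' hM').1.trans (hα m o h hh hP M hM).2)
  have hLpos : (0 : ℝ) < L / 2 := by positivity
  have h4 := optCost_nonneg (M := M) (P := active h) hobj.nonneg 1
  have h5 : 0 < α (active h).card := pos_of_mul_pos_left (hLpos.trans_le h3) h4
  exact h3.trans (mul_le_of_le_one_right h5.le hopt)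

theorem CentersLowerBound.mono {obj : Objective} {k g : ℕ} {f bound bound' : ℕ → ℝ}
    (h : CentersLowerBound obj k g f bound) (hb : ∀ n, 1 ≤ n → bound' n ≤ bound n) :
    CentersLowerBound obj k g f bound' := by
  intro N hN
  obtain ⟨𝒜, h𝒜, H⟩ := h N hN
  refine ⟨𝒜, h𝒜, fun A hA hO α hα => ?_⟩
  obtain ⟨n, h1, h2, h3⟩ := H A hA hO α hα
  exact ⟨n, h1, h2, (hb n (by omega)).trans h3⟩

/-! ## Choice of the parameters -/

theorem half_le_log_max (x : ℝ) : 1 / 2 ≤ Real.log (max 2 x) := by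
  have h1 := Real.log_two_gt_d9
  have h2 := Real.log_le_log (by norm_num) (le_max_left 2 x)
  linarith

theorem half_le_logTime (f : ℕ → ℕ → ℝ) (k n : ℕ) : 1 / 2 ≤ logTime f k n :=
  half_le_log_max _

theorem log_degreeBound_le (f : ℕ → ℝ) (N : ℕ) :
    Real.log ((degreeBound f N : ℝ) + 1) ≤ 5 * Real.log (max 2 (f (2 * N))) := by
  have hF : (2 : ℝ) ≤ max 2 (f (2 * N)) := le_max_left _ _
  have h1 : (degreeBound f N : ℝ) < 8 * max 2 (f (2 * N)) + 1 :=
    Nat.ceil_lt_add_one (by positivity)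
  set F := max 2 (f (2 * N))
  have h2 : (16 : ℝ) ≤ F ^ 4 := by
    calc (16 : ℝ) = 2 ^ 4 := by norm_num
      _ ≤ F ^ 4 := by gcongr
  -- `D + 1 < 8 * F + 2 ≤ 16 * F ≤ F ^ 5`, as `F ≥ 2`.
  have h3 : (degreeBound f N : ℝ) + 1 ≤ F ^ 5 := by
    have : F ^ 5 = F ^ 4 * F := by ring
    nlinarith
  calc Real.log ((degreeBound f N : ℝ) + 1) ≤ Real.log (F ^ 5) :=
        Real.log_le_log (by positivity) h3
    _ = 5 * Real.log F := by rw [Real.log_pow]; norm_num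

theorem log_le_two_mul_log {N n : ℕ} (hN : 2 ≤ N) (hNn : N ≤ n) (hn : n ≤ 2 * N) :
    Real.log n ≤ 2 * Real.log N := by
  have h1 : (0 : ℝ) < n := by exact_mod_cast (by omega : 0 < n)
  have h2 : (n : ℝ) ≤ (N : ℝ) ^ 2 := by
    have : n ≤ N ^ 2 := by nlinarith
    exact_mod_cast this
  calc Real.log n ≤ Real.log ((N : ℝ) ^ 2) := Real.log_le_log h1 h2
    _ = 2 * Real.log N := by rw [Real.log_pow]; norm_num

/-- The source of the argument `2 * n` in the bounds: the time budget is governed by a peak of up to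
`2 * N` points, of which only `n ≥ N` may remain. -/
theorem log_max_le_logTime {f : ℕ → ℕ → ℝ} {k : ℕ} (hf : Monotone (f k)) {N n : ℕ}
    (hNn : N ≤ n) : Real.log (max 2 (f k (2 * N))) ≤ logTime f k (2 * n) :=
  Real.log_le_log (by positivity) (max_le_max_left _ (hf (by omega)))

/-- The ratio of logarithms at any `n ∈ [N, 2N]` is controlled by the one at `N`. -/
theorem log_div_le {f : ℕ → ℕ → ℝ} {k : ℕ} (hf : Monotone (f k)) {N n : ℕ} (hN : 2 ≤ N)
    (hNn : N ≤ n) (hn : n ≤ 2 * N) {z : ℝ} (hz : 0 ≤ z) :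
    Real.log n / (z + logTime f k (2 * n)) ≤
      2 * (Real.log N / (z + Real.log (max 2 (f k (2 * N))))) := by
  have h1 := half_le_log_max (f k (2 * N))
  have h2 := log_max_le_logTime hf hNn
  have h3 : 0 ≤ Real.log N := Real.log_natCast_nonneg N
  rw [← mul_div_assoc]
  exact div_le_div₀ (by positivity) (log_le_two_mul_log hN hNn hn) (by linarith) (by linarith)

theorem le_two_mul_max_floor {x : ℝ} : x ≤ 2 * (max 1 ⌊x⌋₊ : ℕ) := by
  have h1 := Nat.lt_floor_add_one x
  have h2 : (⌊x⌋₊ : ℝ) ≤ (max 1 ⌊x⌋₊ : ℕ) := by exact_mod_cast le_max_right _ _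
  have h3 : (1 : ℝ) ≤ (max 1 ⌊x⌋₊ : ℕ) := by exact_mod_cast le_max_left _ _
  linarith

theorem pow_degreeBound_lt (f : ℕ → ℝ) {N L : ℕ} (hN : 2 ≤ N)
    (hL : ((L - 1 : ℕ) : ℝ) * (5 * Real.log (max 2 (f (2 * N)))) < Real.log N) :
    (degreeBound f N + 1) ^ (L - 1) < N := by
  have h : ((degreeBound f N : ℝ) + 1) ^ (L - 1) < N := by
    rw [← Real.log_lt_log_iff (by positivity) (by positivity), Real.log_pow]
    refine lt_of_le_of_lt ?_ hL
    gcongr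
    exact log_degreeBound_le f N
  exact_mod_cast h

theorem estimateLowerBound_log_div {obj : Objective} (hobj : DiameterLike obj)
    {f : ℕ → ℕ → ℝ} (hf : Monotone (f 1)) {c : ℝ} (hc0 : 0 < c) (hc : c ≤ 1 / 80) :
    EstimateLowerBound obj 1 (f 1) fun n => c * (Real.log n / logTime f 1 (2 * n)) := by
  refine estimateLowerBound_of_separated hobj hf fun N hN => ?_
  have hl := half_le_log_max (f 1 (2 * N))
  have hlogN : 0 < Real.log N := Real.log_pos (by exact_mod_cast hN)
  have hdiv : ∀ n, N ≤ n → n ≤ 2 * N → Real.log n / logTime f 1 (2 * n) ≤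
      2 * (Real.log N / Real.log (max 2 (f 1 (2 * N)))) := fun n h1 h2 => by
    simpa using log_div_le hf hN h1 h2 le_rfl
  set l := Real.log (max 2 (f 1 (2 * N)))
  have hL := @le_two_mul_max_floor (1 / 10 * (Real.log N / l))
  -- The factor `1 / 10` makes `(L - 1) * (5 * l)` at most half of `log N`. Rounding loses a factor
  -- 2, so `L / 2` is at least `1 / 40` of the ratio at `N`, matching `c ≤ 1 / 80` and the factor 2
  -- between the ratios at `n` and `N`.
  refine ⟨max 1 ⌊1 / 10 * (Real.log N / l)⌋₊, le_max_left _ _, pow_degreeBound_lt _ hN ?_,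
    fun n h1 h2 => ?_⟩
  · have h1 : ((max 1 ⌊1 / 10 * (Real.log N / l)⌋₊ - 1 : ℕ) : ℝ) ≤
        1 / 10 * (Real.log N / l) := by
      refine le_trans ?_ (Nat.floor_le (by positivity))
      exact_mod_cast (by omega)
    calc _ ≤ 1 / 10 * (Real.log N / l) * (5 * l) := by gcongr
      _ = Real.log N / 2 := by field_simp; norm_num
      _ < Real.log N := by linarith
  · have h3 := hdiv n h1 h2
    have h4 : 0 ≤ Real.log N / l := by positivity
    calc c * (Real.log n / logTime f 1 (2 * n)) ≤ 1 / 80 * (2 * (Real.log N / l)) := by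
          gcongr
          exact div_nonneg (Real.log_natCast_nonneg n) (by
            have := log_max_le_logTime hf h1
            linarith)
      _ ≤ _ := by linarith

theorem centersLowerBound_center {a : ℕ} (ha : 1 ≤ a) {f : ℕ → ℕ → ℝ} {k : ℕ} (hk : 1 ≤ k)
    (hf : Monotone (f k)) {c : ℝ} (hc0 : 0 < c) (hc : c ≤ 1 / (20 * a)) :
    CentersLowerBound centerObj k (a * k) (f k) fun n =>
      c * min (Real.log n / (k * logTime f k (2 * n))) k := by
  refine centersLowerBound_of_separated centerObj_nonneg hf fun N hN => ?_
  have ha' : (1 : ℝ) ≤ a := by exact_mod_cast ha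
  have hk' : (1 : ℝ) ≤ k := by exact_mod_cast hk
  have hN2 : 2 ≤ N := by nlinarith
  have main : ∀ L, 1 ≤ L → L + 1 ≤ 2 * k → a * k * (degreeBound (f k) N + 1) ^ (L - 1) < N →
      (∀ n, N ≤ n → n ≤ 2 * N →
        c * min (Real.log n / (k * logTime f k (2 * n))) k ≤ L) →
      ∃ L, 1 ≤ L ∧ ∀ h, N ≤ (active h).card → (active h).card ≤ 2 * N →
        Separated h L ((degreeBound (f k) N + 1) ^ (L - 1)) →
        ∀ C : Finset Point, C.Nonempty → C.card ≤ a * k →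
          ∃ M : MetricSpace Point, Consistent M h ∧ ∃ q : ℝ, 0 < q ∧
            optCost centerObj k M (active h) ≤ q ∧ 0 < costOf centerObj M (active h) C ∧
            (c * min (Real.log (active h).card / (k * logTime f k (2 * (active h).card))) k) * q ≤
              costOf centerObj M (active h) C := by
    intro L hL hLk hK hb
    refine ⟨L, hL, fun h h1 h2 hs C hC hCg => ?_⟩
    obtain ⟨M, hM, hcost, hopt⟩ := hs.center hLk (hK.trans_le h1) hC hCg
    have hL' : (1 : ℝ) ≤ L := by exact_mod_cast hL
    refine ⟨M, hM, 1, one_pos, hopt, by linarith, ?_⟩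
    rw [mul_one]
    exact (hb _ h1 h2).trans hcost
  -- Only `L = k` and `L = 1` are needed: if `N` is too small for `L = k`, then the logarithmic term
  -- of the minimum is at most `20 * a` and the claimed bound is at most 1.
  by_cases hcase : a * k * (degreeBound (f k) N + 1) ^ (k - 1) < N
  · refine main k hk (by omega) hcase fun n _ _ => ?_
    have hc1 : c ≤ 1 := hc.trans (by rw [div_le_one (by positivity)]; linarith)
    calc c * min (Real.log n / (k * logTime f k (2 * n))) k ≤ c * k := by
          gcongr
          exact min_le_right _ _
      _ ≤ 1 * k := by gcongr
      _ = k := one_mul _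
  · refine main 1 le_rfl (by omega) (by simpa using hN) fun n h1 h2 => ?_
    have hl := half_le_log_max (f k (2 * N))
    have hlog : Real.log N ≤ a + k + (k : ℝ) * (5 * Real.log (max 2 (f k (2 * N)))) := by
      have hle : (N : ℝ) ≤ a * k * ((degreeBound (f k) N : ℝ) + 1) ^ (k - 1) := by
        exact_mod_cast not_lt.1 hcase
      have h3 := Real.log_le_log (by positivity) hle
      rw [Real.log_mul (by positivity) (by positivity), Real.log_mul (by positivity)
        (by positivity), Real.log_pow] at h3
      have h4 : ((k - 1 : ℕ) : ℝ) ≤ k := by exact_mod_cast Nat.sub_le k 1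
      have h5 : ((k - 1 : ℕ) : ℝ) * Real.log ((degreeBound (f k) N : ℝ) + 1) ≤
          k * (5 * Real.log (max 2 (f k (2 * N)))) :=
        mul_le_mul h4 (log_degreeBound_le _ _)
          (Real.log_nonneg (by linarith [(Nat.cast_nonneg (degreeBound (f k) N) : (0 : ℝ) ≤ _)]))
          (by positivity)
      have h6 := Real.log_le_self (x := (a : ℝ)) (by positivity)
      have h7 := Real.log_le_self (x := (k : ℝ)) (by positivity)
      linarith
    have h3 := log_le_two_mul_log hN2 h1 h2
    have h4 := log_max_le_logTime hf h1
    set l := Real.log (max 2 (f k (2 * N)))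
    have hlt : 0 < logTime f k (2 * n) := by linarith
    have h5 : Real.log n ≤ 20 * a * (k * logTime f k (2 * n)) := by
      have h6 : (a : ℝ) ≤ a * k * (2 * l) := by
        calc (a : ℝ) = a * 1 * 1 := by ring
          _ ≤ a * k * (2 * l) := by gcongr; linarith
      have h7 : (k : ℝ) ≤ a * k * (2 * l) := by
        calc (k : ℝ) = 1 * k * 1 := by ring
          _ ≤ a * k * (2 * l) := by gcongr; linarith
      have h8 : (k : ℝ) * (5 * l) ≤ a * (k * (5 * l)) :=
        le_mul_of_one_le_left (by positivity) ha'
      have h9 : (a : ℝ) * k * l ≤ a * k * logTime f k (2 * n) := by gcongr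
      have h10 : 0 ≤ (a : ℝ) * k * l := by positivity
      linarith
    calc c * min (Real.log n / (k * logTime f k (2 * n))) k
        ≤ c * (20 * a) := by
          gcongr
          exact (min_le_left _ _).trans ((div_le_iff₀ (by positivity)).2 h5)
      _ ≤ 1 / (20 * a) * (20 * a) := by gcongr
      _ = (1 : ℕ) := by field_simp; norm_num

theorem centersLowerBound_power {a : ℕ} (ha : 1 ≤ a) {f : ℕ → ℕ → ℝ} (hf : Monotone (f 1))
    {z : ℝ} (hz : 0 < z) {c : ℝ} (hc0 : 0 < c) (hc : c ≤ 1 / (40 * a)) :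
    CentersLowerBound (powerObj z) 1 a (f 1) fun n =>
      c * (c * (Real.log n / (z + logTime f 1 (2 * n)))) ^ z := by
  refine centersLowerBound_of_separated (powerObj_nonneg z) hf fun N hN => ?_
  have ha' : (1 : ℝ) ≤ a := by exact_mod_cast ha
  have hN2 : 2 ≤ N := by omega
  have hl := half_le_log_max (f 1 (2 * N))
  have hlogN : 0 < Real.log N := Real.log_pos (by exact_mod_cast hN2)
  have hdiv : ∀ n, N ≤ n → n ≤ 2 * N → Real.log n / (z + logTime f 1 (2 * n)) ≤
      2 * (Real.log N / (z + Real.log (max 2 (f 1 (2 * N))))) := fun n h1 h2 =>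
    log_div_le hf hN2 h1 h2 hz.le
  have hdeg := log_degreeBound_le (f 1) N
  set l := Real.log (max 2 (f 1 (2 * N)))
  -- The summand `z` pays for `L ^ z ≤ exp (z * L)`, so that the few points below level `L` do not
  -- dominate the optimum.
  set X := 1 / (10 * a) * (Real.log N / (z + l)) with hX
  have hX0 : 0 < X := by positivity
  have hL := @le_two_mul_max_floor X
  set L := max 1 ⌊X⌋₊ with hLdef
  have hL1 : 1 ≤ L := le_max_left _ _
  have hL1' : (1 : ℝ) ≤ L := by exact_mod_cast hL1
  have hLz : (1 : ℝ) ≤ (L : ℝ) ^ z := Real.one_le_rpow hL1' hz.le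
  -- The two conclusions give cost at least `n / (a + 1) * L ^ z` and optimum at most `2 * n`. For
  -- `L ≥ 2` the choice of `X` even gives `2 * b * L ^ z ≤ N`; for `L = 1`, `b = a` works because `n
  -- ≥ a + 1`.
  have hK : ∃ b : ℕ, a * (degreeBound (f 1) N + 1) ^ (L - 1) ≤ b ∧
      ∀ n : ℕ, N ≤ n → (n : ℝ) / (a + 1) ≤ n - b ∧ (b : ℝ) * (L : ℝ) ^ z ≤ n := by
    rcases le_or_gt 2 L with hL2 | hL2
    · refine ⟨_, le_rfl, fun n hn => ?_⟩
      have hLX : (L : ℝ) ≤ X := by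
        have h1 : L = ⌊X⌋₊ := by omega
        rw [h1]
        exact Nat.floor_le hX0.le
      have hlogX : 10 * a * (X * (z + l)) = Real.log N := by
        rw [hX]
        field_simp
      have hn' : (N : ℝ) ≤ n := by exact_mod_cast hn
      have key : 2 * ((a : ℝ) * ((degreeBound (f 1) N : ℝ) + 1) ^ (L - 1)) * (L : ℝ) ^ z ≤ N := by
        rw [← Real.log_le_log_iff (by positivity) (by positivity),
          Real.log_mul (by positivity) (by positivity), Real.log_mul (by positivity)
          (by positivity), Real.log_mul (by positivity) (by positivity), Real.log_pow,
          Real.log_rpow (by positivity)]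
        have h1 : Real.log 2 ≤ 1 := by linarith [Real.log_two_lt_d9]
        have h2 := Real.log_le_sub_one_of_pos (x := (a : ℝ)) (by positivity)
        have h3 : ((L - 1 : ℕ) : ℝ) * Real.log ((degreeBound (f 1) N : ℝ) + 1) ≤ L * (5 * l) :=
          mul_le_mul (by exact_mod_cast Nat.sub_le L 1) hdeg
            (Real.log_nonneg (by linarith [(Nat.cast_nonneg (degreeBound (f 1) N) : (0 : ℝ) ≤ _)]))
            (by positivity)
        have h4 : z * Real.log L ≤ z * L := by
          gcongr
          exact Real.log_le_self (by positivity)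
        have h5 : (L : ℝ) * (z + l) ≤ X * (z + l) := by gcongr
        have h6 : (1 / 2 : ℝ) ≤ z + l := by linarith
        have h7 : (2 : ℝ) ≤ L := by exact_mod_cast hL2
        have h8 : (1 : ℝ) ≤ X * (z + l) := by
          calc (1 : ℝ) = 2 * (1 / 2) := by norm_num
            _ ≤ L * (z + l) := by gcongr
            _ ≤ _ := h5
        have h9 : (a : ℝ) * 1 ≤ a * (X * (z + l)) := by gcongr
        have h10 : 1 * (X * (z + l)) ≤ a * (X * (z + l)) := by gcongr
        have h11 : 0 ≤ (L : ℝ) * z := by positivity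
        linarith
      set b : ℝ := (a : ℝ) * ((degreeBound (f 1) N : ℝ) + 1) ^ (L - 1)
      have hb0 : 0 ≤ b := by positivity
      have hbz : b ≤ b * (L : ℝ) ^ z := le_mul_of_one_le_right hb0 hLz
      have h12 : (n : ℝ) / (a + 1) ≤ n / 2 := by gcongr; linarith
      push_cast
      constructor <;> linarith
    · have hL' : L = 1 := by omega
      refine ⟨a, by simp [hL'], fun n hn => ⟨?_, ?_⟩⟩
      · have h1 : (a : ℝ) + 1 ≤ n := by exact_mod_cast (by omega : a + 1 ≤ n)
        rw [div_le_iff₀ (by positivity)]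
        nlinarith
      · rw [hL', Nat.cast_one, Real.one_rpow, mul_one]
        exact_mod_cast (by omega : a ≤ n)
  obtain ⟨b, hb, hbn⟩ := hK
  refine ⟨L, hL1, fun h h1 h2 hs C hC hCg => ?_⟩
  obtain ⟨hbn1, hbn2⟩ := hbn _ h1
  have hn0 : (0 : ℝ) < (active h).card := by exact_mod_cast (by omega : 0 < (active h).card)
  have hbP : b < (active h).card := by
    have : (0 : ℝ) < (active h).card / (a + 1) := by positivity
    have : (b : ℝ) < (active h).card := by linarith
    exact_mod_cast this
  obtain ⟨M, hM, hcost, hopt⟩ := hs.power hL1 hb hbP hz hC hCg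
  have hdiv := hdiv _ h1 h2
  have hlt := log_max_le_logTime hf h1
  set n := (active h).card
  have hcost' : (n : ℝ) / (a + 1) * (L : ℝ) ^ z ≤ costOf (powerObj z) M (active h) C :=
    le_trans (by gcongr) hcost
  refine ⟨M, hM, 2 * n, by positivity, by linarith, lt_of_lt_of_le (by positivity) hcost',
    le_trans ?_ hcost'⟩
  have hnn : 0 ≤ Real.log n / (z + logTime f 1 (2 * n)) :=
    div_nonneg (Real.log_natCast_nonneg n) (by linarith)
  have h3 : c * (Real.log n / (z + logTime f 1 (2 * n))) ≤ L := by
    calc c * (Real.log n / (z + logTime f 1 (2 * n)))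
        ≤ 1 / (40 * a) * (2 * (Real.log N / (z + l))) := by gcongr
      _ = X / 2 := by rw [hX]; field_simp; norm_num
      _ ≤ L := by linarith
  have h4 : c ≤ 1 / (2 * (a + 1)) := hc.trans (one_div_le_one_div_of_le (by positivity) (by linarith))
  calc c * (c * (Real.log n / (z + logTime f 1 (2 * n)))) ^ z * (2 * n)
      ≤ 1 / (2 * (a + 1)) * (L : ℝ) ^ z * (2 * n) := by gcongr
    _ = n / (a + 1) * (L : ℝ) ^ z := by field_simp

/-! ### Median and means as the exponents 1 and 2 -/

theorem powerObj_one : powerObj 1 = medianObj := by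
  funext M P C l
  simp [powerObj, medianObj]

theorem powerObj_two : powerObj 2 = meansObj := by
  funext M P C l
  simp [powerObj, meansObj]

/-- Lowering the constant absorbs the exponent `z` next to `logTime`. -/
theorem log_div_logTime_le (f : ℕ → ℕ → ℝ) (n : ℕ) {z : ℝ} (hz : 0 ≤ z) :
    Real.log n / logTime f 1 (2 * n) ≤
      (2 * z + 1) * (Real.log n / (z + logTime f 1 (2 * n))) := by
  have h1 := half_le_logTime f 1 (2 * n)
  have h2 : 0 ≤ Real.log n := Real.log_natCast_nonneg n
  rw [← mul_div_assoc, div_le_div_iff₀ (by linarith) (by linarith)]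
  have : z * 1 ≤ z * (2 * logTime f 1 (2 * n)) := by gcongr; linarith
  nlinarith

theorem centersLowerBound_median {a : ℕ} (ha : 1 ≤ a) {f : ℕ → ℕ → ℝ} (hf : Monotone (f 1))
    {c : ℝ} (hc : c ≤ (1 / (40 * a)) ^ 2 / 3) :
    CentersLowerBound medianObj 1 a (f 1) fun n => c * (Real.log n / logTime f 1 (2 * n)) := by
  rw [← powerObj_one]
  have ha' : (0 : ℝ) < a := by exact_mod_cast ha
  refine (centersLowerBound_power ha hf one_pos (by positivity) le_rfl).mono fun n _ => ?_
  have h1 := log_div_logTime_le f n zero_le_one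
  have h2 : 0 ≤ Real.log n / logTime f 1 (2 * n) :=
    div_nonneg (Real.log_natCast_nonneg n) (by linarith [half_le_logTime f 1 (2 * n)])
  rw [Real.rpow_one]
  set d : ℝ := 1 / (40 * a)
  calc c * (Real.log n / logTime f 1 (2 * n))
      ≤ d ^ 2 / 3 * ((2 * 1 + 1) * (Real.log n / (1 + logTime f 1 (2 * n)))) := by gcongr
    _ = d * (d * (Real.log n / (1 + logTime f 1 (2 * n)))) := by ring

theorem centersLowerBound_means {a : ℕ} (ha : 1 ≤ a) {f : ℕ → ℕ → ℝ} (hf : Monotone (f 1))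
    {c : ℝ} (hc : c ≤ (1 / (40 * a)) ^ 3 / 25) :
    CentersLowerBound meansObj 1 a (f 1) fun n =>
      c * (Real.log n / logTime f 1 (2 * n)) ^ 2 := by
  rw [← powerObj_two]
  have ha' : (0 : ℝ) < a := by exact_mod_cast ha
  refine (centersLowerBound_power ha hf two_pos (by positivity) le_rfl).mono fun n _ => ?_
  have h1 := log_div_logTime_le f n zero_le_two
  have h2 : 0 ≤ Real.log n / logTime f 1 (2 * n) :=
    div_nonneg (Real.log_natCast_nonneg n) (by linarith [half_le_logTime f 1 (2 * n)])
  rw [Real.rpow_two]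
  set d : ℝ := 1 / (40 * a)
  calc c * (Real.log n / logTime f 1 (2 * n)) ^ 2
      -- The denominator 25 is `(2 * z + 1) ^ 2` at `z = 2`.
      ≤ d ^ 3 / 25 * ((2 * 2 + 1) * (Real.log n / (2 + logTime f 1 (2 * n)))) ^ 2 := by gcongr
    _ = d * (d * (Real.log n / (2 + logTime f 1 (2 * n)))) ^ 2 := by ring

end DynClustering

open DynClustering
theorem theorem3 (a : ℕ) (ha : 1 ≤ a) :
    ∃ c : ℝ, 0 < c ∧ ∀ f : ℕ → ℕ → ℝ, (∀ k, Monotone (f k)) →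
      (∀ k : ℕ, 1 ≤ k →
        CentersLowerBound centerObj k (a * k) (f k) fun n =>
          c * min (Real.log n / (k * logTime f k (2 * n))) k) ∧
      (CentersLowerBound medianObj 1 a (f 1) fun n =>
        c * (Real.log n / logTime f 1 (2 * n))) ∧
      (CentersLowerBound meansObj 1 a (f 1) fun n =>
        c * (Real.log n / logTime f 1 (2 * n)) ^ 2) ∧
      (∀ z : ℝ, 0 < z →
        CentersLowerBound (powerObj z) 1 a (f 1) fun n =>
          c * (c * (Real.log n / (z + logTime f 1 (2 * n)))) ^ z) ∧
      (EstimateLowerBound centerObj 1 (f 1) fun n =>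
        c * (Real.log n / logTime f 1 (2 * n))) ∧
      (EstimateLowerBound radiiObj 1 (f 1) fun n =>
        c * (Real.log n / logTime f 1 (2 * n))) ∧
      (EstimateLowerBound diamObj 1 (f 1) fun n =>
        c * (Real.log n / logTime f 1 (2 * n))) := by
  have ha' : (1 : ℝ) ≤ a := by exact_mod_cast ha
  set d : ℝ := 1 / (40 * a) with hd
  have hd0 : 0 < d := by positivity
  have hd1 : d ≤ 1 / 40 := by
    rw [hd]
    gcongr
    linarith
  have hd2 : 0 ≤ d ^ 2 := by positivity
  have h21 : d ^ 2 ≤ 1 / 40 * d := by nlinarith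
  have h32 : d ^ 3 ≤ 1 / 40 * d ^ 2 := by nlinarith
  have hd20 : d ≤ 1 / (20 * a) := by
    rw [hd]
    gcongr
    norm_num
  have hc0 : 0 < d ^ 3 / 25 := by positivity
  have hc80 : d ^ 3 / 25 ≤ 1 / 80 := by linarith
  -- The constant needed for means is the smallest of all, since `d ≤ 1 / 40`.
  refine ⟨d ^ 3 / 25, hc0, fun f hf => ⟨fun k hk => ?_, ?_, ?_, fun z hz => ?_, ?_, ?_, ?_⟩⟩
  · exact centersLowerBound_center ha hk (hf k) hc0 (by linarith)
  · exact centersLowerBound_median ha (hf 1) (by linarith)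
  · exact centersLowerBound_means ha (hf 1) le_rfl
  · exact centersLowerBound_power ha (hf 1) hz hc0 (by linarith)
  · exact estimateLowerBound_log_div diameterLike_centerObj (hf 1) hc0 hc80
  · exact estimateLowerBound_log_div diameterLike_radiiObj (hf 1) hc0 hc80
  · exact estimateLowerBound_log_div diameterLike_diamObj (hf 1) hc0 hc80
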